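/- Let $\mathcal A$ be a unital $C^*$-algebra and $a\in\mathcal A$ selfadjoint. Notation. For $m\ge 1$ let $\mathcal A^{\otimes m}_\gamma$ be the completion of the $m$-fold algebraic tensor product of $\mathcal A$ in the projective norm $\|x\|_\gamma=\inf\sum_i\|a_0^{(i)}\|\cdots\|a_{m-1}^{(i)}\|$ (infimum over all finite representations $x=\sum_i a_0^{(i)}\otimes\cdots\otimes a_{m-1}^{(i)}$); it is a Banach algebra, and the multiplication map $a_0\otimes\cdots\otimes a_n\mapsto a_0\cdots a_n$ extends to a continuous linear map $\mu_n:\mathcal A^{\otimes n+1}_\gamma\to\mathcal A$. For $x\in\mathcal A^{\otimes n+1}_\gamma$ and $b_1,\dots,b_n\in\mathcal A$ the contraction is $x(b_1\cdots b_n):=\mu_n\bigl(x\cdot(b_1\otimes\cdots\otimes b_n\otimes 1)\bigr)$, so that $(a_0\otimes\cdots\otimes a_n)(b_1\cdots b_n)=a_0b_1a_1\cdots b_na_n$. Let $a^{(j)}$ be the elementary tensor with $a$ in slot $j$ and $1$ in the other slots. For a complex-valued function $g$ that is smooth in a neighborhood of $(\operatorname{spec}a)^{m}$ in $\mathbb R^m$,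 put $$g_\gamma(a^{(0)},\dots,a^{(m-1)}):=\int_{\mathbb R^{m}}\hat\varphi(\xi)\,e^{2\pi i\xi_0a}\otimes\cdots\otimes e^{2\pi i\xi_{m-1}a}\,d\xi\in\mathcal A^{\otimes m}_\gamma ,\qquad \hat\varphi(\xi)=\int_{\mathbb R^m}\varphi(x)e^{-2\pi i\langle\xi,x\rangle}\,dx,$$ where $\varphi$ is any Schwartz function on $\mathbb R^m$ that equals $g$ in a neighborhood of $(\operatorname{spec}a)^m$ (the result does not depend on $\varphi$). For a smooth function $f$ on an open subset of $\mathbb R$ the divided differences are defined for pairwise distinct points by $[x_0]f=f(x_0)$ and $[x_0,\dots,x_n]f=\frac{[x_0,\dots,x_{n-1}]f-[x_1,\dots,x_n]f}{x_0-x_n}$, and for repeated points by continuous extension. Finally, $[a^{(0)},\dots,a^{(n)}]f_\gamma:=g_\gamma(a^{(0)},\dots,a^{(n)})$ with $g(x_0,\dots,x_n)=[x_0,\dots,x_n]f$. Statement. (1) Let $U\subset\mathbb R$ be an open neighborhood of $\operatorname{spec}a$ and $f:U\to\mathbb C$ smooth. Then $\operatorname{spec}(a+b)\subset U$ for all sufficiently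 small selfadjoint $b\in\mathcal A$, and the Taylor expansion of $f(a+b)$ as $b\to0$ through selfadjoint elements is $$f(a+b)\sim_{b\to0}\sum_{n=0}^\infty\bigl([a^{(0)},\dots,a^{(n)}]f_\gamma\bigr)(b\cdots b),$$ that is, for every $N\in\mathbb N$, $$\Bigl\|f(a+b)-\sum_{n=0}^{N-1}\bigl([a^{(0)},\dots,a^{(n)}]f_\gamma\bigr)(b\cdots b)\Bigr\|=O(\|b\|^N)\qquad(b=b^*\to0).$$ Here $f(a+b)$ is given by the continuous functional calculus. (2) For $f=\exp$ and every selfadjoint $b\in\mathcal A$ the series converges in norm (unconditionally) and $$e^{a+b}=\sum_{n=0}^\infty\bigl([a^{(0)},\dots,a^{(n)}]\exp_\gamma\bigr)(b\cdots b).$$ -/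

import Mathlib

open scoped TensorProduct FourierTransform SchwartzMap ContDiff Topology

namespace MagnusTaylor

noncomputable section

/-! ### Divided differences -/

/-- The recursive divided difference `[x₀, …, xₙ] f` of pairwise distinct points:
`[x₀] f = f x₀` and
`[x₀, …, xₙ₊₁] f = ([x₀, …, xₙ] f - [x₁, …, xₙ₊₁] f) / (x₀ - xₙ₊₁)`.
It is only meaningful for pairwise distinct points. -/
def divDiffRec (f : ℝ → ℂ) : (n : ℕ) → (Fin (n + 1) → ℝ) → ℂ
  | 0, x => f (x 0)
  | n + 1, x =>
      (divDiffRec f n (Fin.init x) - divDiffRec f n (Fin.tail x)) /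
        ((x 0 - x (Fin.last (n + 1)) : ℝ) : ℂ)

/-- The divided difference `[x₀, …, xₙ] f` of a smooth function, for arbitrary (possibly
repeated) points: the extension by continuity from the tuples of pairwise distinct points. -/
def divDiff (f : ℝ → ℂ) (n : ℕ) : (Fin (n + 1) → ℝ) → ℂ :=
  extendFrom {x | Function.Injective x} (divDiffRec f n)

/-! ### The projective tensor product and the contraction map -/

section Tensor

variable (A : Type*) [CStarAlgebra A]

/-- The projective tensor product completion of the `m`-fold algebraic tensor product of `A`
(Mathlib's norm on `⨂[ℂ] _, A` is the projective one). -/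
abbrev ProjTensor (m : ℕ) : Type _ :=
  UniformSpace.Completion (⨂[ℂ] _ : Fin m, A)

variable {A}

/-- The elementary tensor `a₀ ⊗ ⋯ ⊗ aₘ₋₁` in the projective tensor product. -/
def elemTensor {m : ℕ} (a : Fin m → A) : ProjTensor A m :=
  ((PiTensorProduct.tprod ℂ a : ⨂[ℂ] _ : Fin m, A) : ProjTensor A m)

variable (A) in
/-- The multiplication map `a₀ ⊗ ⋯ ⊗ aₘ₋₁ ↦ a₀ ⋯ aₘ₋₁`, extended by continuity to the
projective tensor product. -/
def mulMap (m : ℕ) : ProjTensor A m →L[ℂ] A :=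
  (PiTensorProduct.liftIsometry ℂ (fun _ : Fin m => A) A
    (ContinuousMultilinearMap.mkPiAlgebraFin ℂ m A)).fromCompletion

/-- Right multiplication by the elementary tensor `c₀ ⊗ ⋯ ⊗ cₘ₋₁` in the Banach algebra
`ProjTensor A m`: the continuous linear map with
`a₀ ⊗ ⋯ ⊗ aₘ₋₁ ↦ (a₀ c₀) ⊗ ⋯ ⊗ (aₘ₋₁ cₘ₋₁)`. -/
def mulRightElem {m : ℕ} (c : Fin m → A) : ProjTensor A m →L[ℂ] ProjTensor A m :=
  (PiTensorProduct.mapL fun j => (ContinuousLinearMap.mul ℂ A).flip (c j)).completion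

/-- The contraction `x(b₁ ⋯ bₙ) = μₙ (x · (b₁ ⊗ ⋯ ⊗ bₙ ⊗ 1))` of an element `x` of the
`(n + 1)`-fold projective tensor product. -/
def contract {n : ℕ} (x : ProjTensor A (n + 1)) (b : Fin n → A) : A :=
  mulMap A (n + 1) (mulRightElem (Fin.snoc (α := fun _ => A) b 1) x)

theorem mulMap_elemTensor {m : ℕ} (a : Fin m → A) :
    mulMap A m (elemTensor a) = (List.ofFn a).prod := by
  simp [mulMap, elemTensor]

theorem mulRightElem_elemTensor {m : ℕ} (c a : Fin m → A) :
    mulRightElem c (elemTensor a) = elemTensor (fun j => a j * c j) := by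
  simp [mulRightElem, elemTensor]

/-- `mulRightElem c` extends right multiplication by `c₀ ⊗ ⋯ ⊗ cₘ₋₁` in the algebraic tensor
product. -/
theorem mulRightElem_coe {m : ℕ} (c : Fin m → A) (x : ⨂[ℂ] _ : Fin m, A) :
    mulRightElem c (x : ProjTensor A m) =
      ((x * PiTensorProduct.tprod ℂ c : ⨂[ℂ] _ : Fin m, A) : ProjTensor A m) := by
  simp only [mulRightElem, ContinuousLinearMap.completion_apply_coe]
  congr 1
  induction x using PiTensorProduct.induction_on with
  | smul_tprod r a =>
    rw [map_smul, smul_mul_assoc, PiTensorProduct.tprod_mul_tprod]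
    simp [Pi.mul_def]
  | add x y hx hy => rw [map_add, hx, hy, add_mul]

/-- On elementary tensors the contraction is
`(a₀ ⊗ ⋯ ⊗ aₙ)(b₁ ⋯ bₙ) = (a₀ b₁) (a₁ b₂) ⋯ (aₙ₋₁ bₙ) aₙ`. -/
theorem contract_elemTensor {n : ℕ} (a : Fin (n + 1) → A) (b : Fin n → A) :
    contract (elemTensor a) b =
      (List.ofFn fun j : Fin n => a j.castSucc * b j).prod * a (Fin.last n) := by
  rw [contract, mulRightElem_elemTensor, mulMap_elemTensor, List.ofFn_succ', List.concat_eq_append,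
    List.prod_append]
  simp

/-! ### The smooth functional calculus in the projective tensor product -/

/-- The elementary tensor
`exp (2πi ∑ⱼ ξⱼ a⁽ʲ⁾) = e^{2πi ξ₀ a} ⊗ ⋯ ⊗ e^{2πi ξₘ₋₁ a}` of the projective tensor product. -/
def expTensor {m : ℕ} (a : A) (ξ : EuclideanSpace ℝ (Fin m)) : ProjTensor A m :=
  elemTensor fun j => NormedSpace.exp ((2 * Real.pi * Complex.I * (ξ j : ℂ)) • a)

/-- The functional calculus for a Schwartz function `φ` of `m` real variables: the Bochner integral
`φ_γ(a⁽⁰⁾, …, a⁽ᵐ⁻¹⁾) = ∫ φ̂(ξ) e^{2πi ξ₀ a} ⊗ ⋯ ⊗ e^{2πi ξₘ₋₁ a} dξ`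
in the projective tensor product, where `φ̂(ξ) = ∫ φ(x) e^{-2πi ⟨ξ, x⟩} dx`. -/
def schwartzCalculus {m : ℕ} (a : A) (φ : 𝓢(EuclideanSpace ℝ (Fin m), ℂ)) : ProjTensor A m :=
  ∫ ξ : EuclideanSpace ℝ (Fin m), (𝓕 φ) ξ • expTensor a ξ

/-- The Schwartz function `φ` agrees with `g` in a neighborhood of `(spec a)ᵐ`. -/
def AgreesNearSpectrum {m : ℕ} (a : A) (g : (Fin m → ℝ) → ℂ)
    (φ : 𝓢(EuclideanSpace ℝ (Fin m), ℂ)) : Prop :=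
  ∀ᶠ x in 𝓝ˢ {x : EuclideanSpace ℝ (Fin m) | ∀ j, x j ∈ spectrum ℝ a}, φ x = g x.ofLp

open Classical in
/-- The smooth functional calculus `g_γ(a⁽⁰⁾, …, a⁽ᵐ⁻¹⁾)` of a selfadjoint element `a`, for a
function `g` that is smooth in a neighborhood of the compact set `(spec a)ᵐ`: it is computed from
any Schwartz function that agrees with `g` in a neighborhood of `(spec a)ᵐ` (the result does not
depend on which one; such a function exists because `g` is smooth there). -/
def smoothCalculus {m : ℕ} (a : A) (g : (Fin m → ℝ) → ℂ) : ProjTensor A m :=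
  if h : ∃ φ : 𝓢(EuclideanSpace ℝ (Fin m), ℂ), AgreesNearSpectrum a g φ then
    schwartzCalculus a h.choose
  else 0

/-- The `n`-th term `([a⁽⁰⁾, …, a⁽ⁿ⁾] f_γ)(b ⋯ b)` of the expansion: insert `a⁽⁰⁾, …, a⁽ⁿ⁾` into
`(x₀, …, xₙ) ↦ [x₀, …, xₙ] f` and contract with `b ⊗ ⋯ ⊗ b`. -/
def taylorTerm (f : ℝ → ℂ) (a : A) (n : ℕ) (b : A) : A :=
  contract (smoothCalculus a (divDiff f n)) fun _ : Fin n => b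

end Tensor

end

end MagnusTaylor

/-! The proof is Fourier inversion plus Duhamel's formula. Near `spec a` replace `f` by a Schwartz
function `ψ`. For small selfadjoint `b` the spectrum of `a + b` stays where the two agree, so `f(a +
b) = ∫ ψ̂(ξ) e^{2πiξ(a+b)} dξ` (`integral_fourier_smul_expI`). Iterating Duhamel's formula expands
the exponential (`exp_add_eq_sum_duhamel`). All exponentials involved are unitary, so the `N`-th
remainder is at most `(2π|ξ|‖b‖)^N / N!`, and the moments of `ψ̂` are finite. This gives `O(‖b‖^N)`
(`norm_cfc_sub_sum_le`).

It remains to identify the terms (`taylorTerm_eq_integral`). The `n`-th Duhamel term is `(2πiξ)^n`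
times an integral of `e^{2πiξu₀a} b ⋯ b e^{2πiξuₙa}` over the simplex
(`iterate_duhamel_eq_integral`). By the Hermite–Genocchi formula (`divDiffRec_exp`) the scalar
function with the same Fourier representation is the divided difference of `ψ`. The calculus,
however, uses an arbitrary Schwartz function that matches the divided difference only near the
spectrum. `integral_smul_multilinear_expI` removes this ambiguity: such operator integrals depend
only on their scalar symbols on the support of a product cutoff equal to 1 on the spectrum.

For `exp`, the Duhamel series converges absolutely. Along `t • b` it and the Taylor expansion are
both expansions of `e^{a+tb}` in powers of `t`, so their coefficients coincide (`taylorTerm_exp`).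
-/

namespace MagnusTaylor

noncomputable section

open MeasureTheory

/-! ### The one-parameter group `e^{2πi t a}` -/

section OneParameter

variable {A : Type*} [CStarAlgebra A]

/-- The one-parameter group `t ↦ e^{2πi t a}`. -/
def expI (a : A) (t : ℝ) : A := NormedSpace.exp ((2 * Real.pi * Complex.I * (t : ℂ)) • a)

theorem expI_add (a : A) (s t : ℝ) : expI a (s + t) = expI a s * expI a t := by
  let +nondep : NormedAlgebra ℚ A := .restrictScalars ℚ ℂ A
  rw [expI, expI, expI, ← NormedSpace.exp_add_of_commute, ← add_smul]
  · push_cast; ring_nf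
  · exact ((Commute.refl a).smul_left _).smul_right _

@[fun_prop]
theorem continuous_expI (a : A) : Continuous (expI a) := by
  let +nondep : NormedAlgebra ℚ A := .restrictScalars ℚ ℂ A
  unfold expI
  exact NormedSpace.exp_continuous.comp (by fun_prop)

theorem expI_mem_unitary {a : A} (ha : IsSelfAdjoint a) (t : ℝ) : expI a t ∈ unitary A := by
  let +nondep : NormedAlgebra ℚ A := .restrictScalars ℚ ℂ A
  refine NormedSpace.exp_mem_unitary_of_mem_skewAdjoint (ha.smul_mem_skewAdjoint ?_)
  simp [skewAdjoint.mem_iff]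

theorem norm_expI_le {a : A} (ha : IsSelfAdjoint a) (t : ℝ) : ‖expI a t‖ ≤ 1 := by
  cases subsingleton_or_nontrivial A
  · simp [Subsingleton.elim (expI a t) 0]
  · exact (CStarRing.norm_of_mem_unitary (expI_mem_unitary ha t)).le

theorem expI_eq_cfc {a : A} (ha : IsSelfAdjoint a) (t : ℝ) :
    expI a t = cfc (fun z : ℂ => Complex.exp (2 * Real.pi * Complex.I * (t : ℂ) * z)) a := by
  have : IsStarNormal a := ha.isStarNormal
  have h := cfc_comp_smul (2 * Real.pi * Complex.I * (t : ℂ)) Complex.exp a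
  simp only [smul_eq_mul] at h
  rw [h, CFC.complex_exp_eq_normedSpace_exp, expI]

theorem integral_fourier_mul_exp (ψ : 𝓢(ℝ, ℂ)) (x : ℝ) :
    ∫ t : ℝ, (𝓕 ψ) t * Complex.exp (2 * Real.pi * Complex.I * t * x) = ψ x := by
  have h : (𝓕⁻ (𝓕 ψ)) x = ψ x := by rw [FourierTransform.fourierInv_fourier_eq]
  rw [← h, SchwartzMap.fourierInv_coe, Real.fourierInv_eq']
  refine integral_congr_ae (.of_forall fun t => ?_)
  simp only [smul_eq_mul]
  rw [mul_comm]
  congr 2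
  simp
  ring

/-- Fourier inversion carried through the continuous functional calculus. The spectrum is real, so
the exponentials have modulus one on it and `‖𝓕 ψ‖` dominates the integrand. -/
theorem integral_fourier_smul_expI {a : A} (ha : IsSelfAdjoint a) (ψ : 𝓢(ℝ, ℂ)) :
    ∫ t, (𝓕 ψ) t • expI a t = cfc (fun z : ℂ => ψ z.re) a := by
  have hn : IsStarNormal a := ha.isStarNormal
  have hre : ∀ z ∈ spectrum ℂ a, z = (z.re : ℂ) := fun z hz => ha.mem_spectrum_eq_re hz
  have hF : Integrable (𝓕 ψ : 𝓢(ℝ, ℂ)) := (𝓕 ψ).integrable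
  have hcont : Continuous (𝓕 ψ : 𝓢(ℝ, ℂ)) := (𝓕 ψ).continuous
  have key := cfc_integral (𝕜 := ℂ) (μ := (volume : Measure ℝ))
    (fun (t : ℝ) (z : ℂ) => (𝓕 ψ) t * Complex.exp (2 * Real.pi * Complex.I * (t : ℂ) * z))
    (fun t => ‖(𝓕 ψ) t‖) a (by
      apply Continuous.continuousOn
      simp only [Function.uncurry_def]
      fun_prop) (by
      refine .of_forall fun t z hz => ?_
      rw [hre z hz, norm_mul, Complex.norm_exp]
      simp) hF.norm.2
  rw [cfc_congr (g := fun z : ℂ => ψ z.re)] at key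
  · rw [key]
    refine integral_congr_ae (.of_forall fun t => ?_)
    simp only
    rw [expI_eq_cfc ha, ← cfc_smul _ _ a]
    rfl
  · intro z hz
    simp only
    rw [← integral_fourier_mul_exp ψ z.re, ← hre z hz]

/-- A reproducing formula: translating by `s` splits off the factor `expI a s`, and what is left is
`χ(a) = 1`. It lets the spectral cutoff `χ` be inserted into any exponential. -/
theorem integral_fourier_smul_expI_sub {a : A} (ha : IsSelfAdjoint a) {χ : 𝓢(ℝ, ℂ)}
    (hχ : ∀ x ∈ spectrum ℝ a, χ x = 1) (s : ℝ) :
    ∫ t, (𝓕 χ) (t - s) • expI a t = expI a s := by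
  have hn : IsStarNormal a := ha.isStarNormal
  have h1 : ∫ t, (𝓕 χ) t • expI a t = 1 := by
    rw [integral_fourier_smul_expI ha, cfc_congr (g := fun _ => (1 : ℂ)), cfc_const_one ℂ a]
    intro z hz
    refine hχ _ ?_
    rw [← spectrum.algebraMap_mem_iff ℂ]
    simpa [← ha.mem_spectrum_eq_re hz] using hz
  rw [← integral_add_right_eq_self _ s]
  simp only [add_sub_cancel_right, expI_add, ← smul_mul_assoc]
  rw [integral_mul_const_of_integrable, h1, one_mul]
  refine ((𝓕 χ).integrable (μ := volume)).norm.mono' (by fun_prop) (.of_forall fun t => ?_)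
  rw [norm_smul]
  exact mul_le_of_le_one_right (norm_nonneg _) (norm_expI_le ha t)

end OneParameter

/-! ### Multilinear maps and product integrals -/

section Multilinear

variable {A F : Type*} [NormedAddCommGroup A] [NormedSpace ℂ A]
  [NormedAddCommGroup F] [NormedSpace ℂ F]

theorem integrable_multilinear {m : ℕ} (M : ContinuousMultilinearMap ℂ (fun _ : Fin m => A) F)
    {g : Fin m → ℝ → A} (hc : ∀ j, Continuous (g j)) (hg : ∀ j, Integrable (g j)) :
    Integrable fun x : Fin m → ℝ => M fun j => g j (x j) := by
  have hb : Integrable fun x : Fin m → ℝ => ‖M‖ * ∏ j, ‖g j (x j)‖ :=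
    (Integrable.fintype_prod (μ := fun _ => volume) (f := fun j t => ‖g j t‖)
      fun j => (hg j).norm).const_mul _
  refine hb.mono' ?_ (.of_forall fun x => M.le_opNorm _)
  exact (M.cont.comp (continuous_pi fun j => (hc j).comp (continuous_apply j))).aestronglyMeasurable

/-- Fubini one slot at a time: the induction hypothesis handles the last `m` variables, and
evaluation at their fixed integrals is continuous linear in the first slot. -/
theorem integral_multilinear [CompleteSpace A] [CompleteSpace F] : ∀ {m : ℕ}
    (M : ContinuousMultilinearMap ℂ (fun _ : Fin m => A) F)
    {g : Fin m → ℝ → A} (_ : ∀ j, Continuous (g j)) (_ : ∀ j, Integrable (g j)),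
    ∫ x : Fin m → ℝ, M (fun j => g j (x j)) = M fun j => ∫ t, g j t := by
  intro m
  induction m with
  | zero =>
    intro M g _ _
    rw [integral_unique]
    simp [Measure.volume_pi_eq_dirac default]
    congr 1
    exact Subsingleton.elim _ _
  | succ m ih =>
    intro M g hc hg
    have hmp := (volume_preserving_piFinSuccAbove (fun _ : Fin (m + 1) => ℝ) 0).symm
    have hint : Integrable (fun p : ℝ × (Fin m → ℝ) =>
        M.curryLeft (g 0 p.1) (fun j => g j.succ (p.2 j))) (volume.prod volume) := by
      have := (hmp.integrable_comp_emb (MeasurableEquiv.measurableEmbedding _)).2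
        (integrable_multilinear M hc hg)
      refine this.congr (.of_forall fun p => ?_)
      simp only [Function.comp, ContinuousMultilinearMap.curryLeft_apply]
      congr 1
      funext j
      refine Fin.cases ?_ (fun j => ?_) j <;> simp
    rw [← hmp.integral_comp (MeasurableEquiv.measurableEmbedding _)]
    calc _ = ∫ p : ℝ × (Fin m → ℝ), M.curryLeft (g 0 p.1) (fun j => g j.succ (p.2 j))
          ∂(volume.prod volume) := by
            refine integral_congr_ae (.of_forall fun p => ?_)
            simp only [ContinuousMultilinearMap.curryLeft_apply]
            congr 1
            funext j
            refine Fin.cases ?_ (fun j => ?_) j <;> simp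
      _ = ∫ t, M.curryLeft (g 0 t) (fun j => ∫ s, g j.succ s) := by
            rw [integral_prod _ hint]
            refine integral_congr_ae (.of_forall fun t => ?_)
            exact ih (M.curryLeft (g 0 t)) (fun j => hc j.succ) fun j => hg j.succ
      _ = _ := by
            let L : A →L[ℂ] F := (ContinuousMultilinearMap.apply ℂ (fun _ : Fin m => A) F
              (fun j => ∫ s, g j.succ s)).comp
                (M.curryLeft : A →L[ℂ] ContinuousMultilinearMap ℂ (fun _ : Fin m => A) F)
            have := L.integral_comp_comm (hg 0)
            change ∫ t, L (g 0 t) = _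
            rw [this]
            change M _ = _
            congr 1
            funext j
            refine Fin.cases ?_ (fun j => ?_) j <;> simp

end Multilinear

/-! ### Multilinear expressions in the one-parameter group and their symbols -/

section Symbol

variable {A F : Type*} [CStarAlgebra A] [NormedAddCommGroup F] [NormedSpace ℂ F]
  {m : ℕ} (M : ContinuousMultilinearMap ℂ (fun _ : Fin m => A) F)

theorem norm_multilinear_expI_le {a : A} (ha : IsSelfAdjoint a) (θ : Fin m → ℝ) :
    ‖M fun j => expI a (θ j)‖ ≤ ‖M‖ := by
  refine (M.le_opNorm _).trans (mul_le_of_le_one_right (norm_nonneg _) ?_)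
  exact Finset.prod_le_one (fun _ _ => norm_nonneg _) fun j _ => norm_expI_le ha _

@[fun_prop]
theorem continuous_multilinear_expI (a : A) :
    Continuous fun θ : Fin m → ℝ => M fun j => expI a (θ j) :=
  M.cont.comp (by fun_prop)

theorem norm_exp_two_pi_I (t : ℝ) : ‖Complex.exp (2 * Real.pi * Complex.I * t)‖ = 1 := by
  simp [Complex.norm_exp]

theorem fourier_mul_eq_integral (χ : 𝓢(ℝ, ℂ)) (t : ℝ) :
    (𝓕 χ) t = ∫ x : ℝ, χ x * Complex.exp (2 * Real.pi * Complex.I * ((-(t * x) : ℝ) : ℂ)) := by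
  rw [SchwartzMap.fourier_coe, Real.fourier_real_eq_integral_exp_smul]
  refine integral_congr_ae (.of_forall fun x => ?_)
  simp only [smul_eq_mul]
  rw [mul_comm]
  congr 2
  push_cast
  ring

theorem integrable_prod_schwartz (χ : 𝓢(ℝ, ℂ)) :
    Integrable fun x : Fin m → ℝ => ∏ j, χ (x j) :=
  Integrable.fintype_prod (μ := fun _ => volume) (f := fun _ t => χ t) fun _ => χ.integrable

theorem prod_fourier_eq_integral (χ : 𝓢(ℝ, ℂ)) (θ : Fin m → ℝ) :
    ∏ j, (𝓕 χ) (θ j) = ∫ x : Fin m → ℝ, (∏ j, χ (x j)) *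
      Complex.exp (2 * Real.pi * Complex.I * ((-∑ j, θ j * x j : ℝ) : ℂ)) := by
  simp only [fourier_mul_eq_integral χ]
  rw [← integral_fintype_prod_eq_prod (μ := fun _ : Fin m => (volume : Measure ℝ))
    (fun j (x : ℝ) => χ x * Complex.exp (2 * Real.pi * Complex.I * ((-(θ j * x) : ℝ) : ℂ)))]
  refine integral_congr_ae (.of_forall fun x => ?_)
  simp only
  rw [Finset.prod_mul_distrib, ← Complex.exp_sum]
  congr 2
  push_cast
  rw [← Finset.mul_sum, Finset.sum_neg_distrib]

variable [CompleteSpace F]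

theorem integral_prod_fourier_smul {a : A} (ha : IsSelfAdjoint a) {χ : 𝓢(ℝ, ℂ)}
    (hχ : ∀ x ∈ spectrum ℝ a, χ x = 1) (η : Fin m → ℝ) :
    ∫ θ : Fin m → ℝ, (∏ j, (𝓕 χ) (θ j - η j)) • M (fun j => expI a (θ j)) =
      M fun j => expI a (η j) := by
  have hc : Continuous (𝓕 χ : 𝓢(ℝ, ℂ)) := (𝓕 χ).continuous
  have hint (s : ℝ) : Integrable fun t => (𝓕 χ) (t - s) • expI a t := by
    refine ((𝓕 χ).integrable (μ := volume)).comp_sub_right s |>.norm.mono' (by fun_prop)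
      (.of_forall fun t => ?_)
    rw [norm_smul]
    exact mul_le_of_le_one_right (norm_nonneg _) (norm_expI_le ha t)
  have := integral_multilinear M (g := fun j t => (𝓕 χ) (t - η j) • expI a t)
    (fun j => by fun_prop) fun j => hint _
  simpa only [integral_fourier_smul_expI_sub ha hχ, M.map_smul_univ] using this

/-- An integral of `M (e^{2πi η₁ a}, …, e^{2πi ηₘ a})` against an integrable density depends only
on the values of its symbol `x ↦ ∫ h e^{2πi ⟨η, x⟩}` on the support of `χ ⊗ ⋯ ⊗ χ`. -/
theorem integral_smul_multilinear_expI {a : A} (ha : IsSelfAdjoint a) {χ : 𝓢(ℝ, ℂ)}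
    (hχ : ∀ x ∈ spectrum ℝ a, χ x = 1) {Ω : Type*} [MeasurableSpace Ω] (ν : Measure Ω) [SFinite ν]
    {h : Ω → ℂ} (hh : Integrable h ν) {η : Ω → Fin m → ℝ} (hη : Measurable η) :
    ∫ w, h w • M (fun j => expI a (η w j)) ∂ν =
      ∫ θ : Fin m → ℝ, (∫ x : Fin m → ℝ,
        (Complex.exp (2 * Real.pi * Complex.I * ((-∑ j, θ j * x j : ℝ) : ℂ))) *
        ((∏ j, χ (x j)) *
          ∫ w, h w * Complex.exp (2 * Real.pi * Complex.I * ((∑ j, η w j * x j : ℝ) : ℂ)) ∂ν)) •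
        M fun j => expI a (θ j) := by
  have hc : Continuous (𝓕 χ : 𝓢(ℝ, ℂ)) := (𝓕 χ).continuous
  have hP : Integrable fun θ : Fin m → ℝ => ∏ j, (𝓕 χ) (θ j) := integrable_prod_schwartz (𝓕 χ)
  have hPc : Continuous fun θ : Fin m → ℝ => ∏ j, (𝓕 χ) (θ j) := by fun_prop
  have hshift (s : Fin m → ℝ) : Integrable fun θ : Fin m → ℝ => ∏ j, (𝓕 χ) (θ j - s j) :=
    hP.comp_sub_right s
  have hη1 : Measurable fun p : Ω × (Fin m → ℝ) => p.2 - η p.1 :=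
    measurable_snd.sub (hη.comp measurable_fst)
  -- By translation invariance the `L¹` norm in `θ` does not depend on `η w`, so joint integrability
  -- reduces to that of `h`.
  have hscal : Integrable (fun p : Ω × (Fin m → ℝ) => h p.1 * ∏ j, (𝓕 χ) (p.2 j - η p.1 j))
      (ν.prod volume) := by
    rw [integrable_prod_iff]
    · refine ⟨.of_forall fun w => (hshift (η w)).const_mul (h w), ?_⟩
      simp only [norm_mul]
      have h1 (w : Ω) : ∫ θ : Fin m → ℝ, ‖h w‖ * ‖∏ j, (𝓕 χ) (θ j - η w j)‖ =
          ‖h w‖ * ∫ θ : Fin m → ℝ, ‖∏ j, (𝓕 χ) (θ j)‖ := by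
        rw [integral_const_mul]
        congr 1
        exact integral_sub_right_eq_self (μ := volume) (fun θ : Fin m → ℝ => ‖∏ j, (𝓕 χ) (θ j)‖) (η w)
      simp only [h1]
      exact hh.norm.mul_const _
    · exact hh.1.comp_fst.mul (hPc.measurable.comp hη1).aestronglyMeasurable
  have hmain : Integrable (Function.uncurry fun (w : Ω) (θ : Fin m → ℝ) =>
      (h w * ∏ j, (𝓕 χ) (θ j - η w j)) • M fun j => expI a (θ j)) (ν.prod volume) := by
    refine (hscal.norm.mul_const ‖M‖).mono' ?_ (.of_forall fun p => ?_)
    · refine hscal.1.smul ?_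
      exact ((continuous_multilinear_expI M a).aestronglyMeasurable (μ := volume)).comp_snd
    · simp only [Function.uncurry, norm_smul]
      gcongr
      exact norm_multilinear_expI_le M ha _
  calc ∫ w, h w • M (fun j => expI a (η w j)) ∂ν
      = ∫ w, (∫ θ : Fin m → ℝ,
          (h w * ∏ j, (𝓕 χ) (θ j - η w j)) • M (fun j => expI a (θ j))) ∂ν := by
        refine integral_congr_ae (.of_forall fun w => ?_)
        simp only
        rw [← integral_prod_fourier_smul M ha hχ (η w), ← integral_smul]
        simp only [mul_smul]
    _ = ∫ θ : Fin m → ℝ, (∫ w, h w * ∏ j, (𝓕 χ) (θ j - η w j) ∂ν) • M (fun j => expI a (θ j)) := by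
        rw [integral_integral_swap hmain]
        refine integral_congr_ae (.of_forall fun θ => ?_)
        exact integral_smul_const _ _
    _ = _ := by
        refine integral_congr_ae (.of_forall fun θ => ?_)
        simp only
        congr 1
        have hsw : Integrable (Function.uncurry fun (w : Ω) (x : Fin m → ℝ) =>
            h w * ((∏ j, χ (x j)) *
              Complex.exp (2 * Real.pi * Complex.I * ((-∑ j, (θ j - η w j) * x j : ℝ) : ℂ))))
            (ν.prod volume) := by
          have hb := hh.mul_prod (integrable_prod_schwartz (m := m) χ)
          refine hb.norm.mono' ?_ (.of_forall fun p => ?_)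
          · have : AEStronglyMeasurable (fun p : Ω × (Fin m → ℝ) =>
                Complex.exp (2 * Real.pi * Complex.I *
                  ((-∑ j, (θ j - η p.1 j) * p.2 j : ℝ) : ℂ))) (ν.prod volume) := by
              apply Measurable.aestronglyMeasurable
              have : ∀ j, Measurable fun p : Ω × (Fin m → ℝ) => (θ j - η p.1 j) * p.2 j :=
                fun j => (((measurable_pi_apply j).comp (hη.comp measurable_fst)).const_sub _).mul
                  ((measurable_pi_apply j).comp measurable_snd)
              fun_prop
            refine (hb.1.mul this).congr (.of_forall fun p => ?_)
            simp [Function.uncurry, mul_assoc]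
          · simp only [Function.uncurry, norm_mul, norm_exp_two_pi_I, mul_one]
            exact le_rfl
        -- Writing the shifted transforms as integrals over `x` separates the phases in `θ` and `η
        -- w`; a second Fubini then makes the symbol appear.
        simp only [fun w => prod_fourier_eq_integral χ fun j => θ j - η w j, ← integral_const_mul]
        rw [integral_integral_swap hsw]
        refine integral_congr_ae (.of_forall fun x => ?_)
        refine integral_congr_ae (.of_forall fun w => ?_)
        have : Complex.exp (2 * Real.pi * Complex.I * ((-∑ j, (θ j - η w j) * x j : ℝ) : ℂ)) =
            Complex.exp (2 * Real.pi * Complex.I * ((-∑ j, θ j * x j : ℝ) : ℂ)) *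
            Complex.exp (2 * Real.pi * Complex.I * ((∑ j, η w j * x j : ℝ) : ℂ)) := by
          rw [← Complex.exp_add, ← mul_add, ← Complex.ofReal_add]
          congr 3
          simp only [sub_mul, Finset.sum_sub_distrib]
          ring
        simp only [this]
        ring

end Symbol

/-! ### Lebesgue measure on the simplex -/

section Simplex

/-- The measure `sⁿ ds` on the unit interval. -/
def powMeasure (n : ℕ) : Measure ℝ :=
  (volume.restrict (Set.Ioc 0 1)).withDensity fun s => ((s.toNNReal ^ n : NNReal) : ENNReal)

/-- The map `(s, u) ↦ (s u₀, …, s uₙ, 1 - s)` from the cone over the `n`-simplex to the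
`(n + 1)`-simplex. -/
def coneMap (n : ℕ) (p : ℝ × (Fin (n + 1) → ℝ)) : Fin (n + 2) → ℝ :=
  Fin.snoc (α := fun _ => ℝ) (p.1 • p.2) (1 - p.1)

/-- The Lebesgue measure on the standard `n`-simplex, of total mass `1 / n!`. -/
def simplexMeasure : (n : ℕ) → Measure (Fin (n + 1) → ℝ)
  | 0 => Measure.dirac fun _ => 1
  | n + 1 => ((powMeasure n).prod (simplexMeasure n)).map (coneMap n)

theorem powMeasure_ae (n : ℕ) : ∀ᵐ s ∂powMeasure n, s ∈ Set.Ioc (0 : ℝ) 1 :=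
  (withDensity_absolutelyContinuous _ _).ae_le (ae_restrict_mem measurableSet_Ioc)

instance (n : ℕ) : IsFiniteMeasure (powMeasure n) := by
  refine isFiniteMeasure_withDensity ?_
  refine ne_of_lt (lt_of_le_of_lt (setLIntegral_mono' (g := fun _ => 1) measurableSet_Ioc ?_) ?_)
  · intro s hs
    have : s.toNNReal ≤ 1 := by simpa using hs.2
    exact_mod_cast pow_le_one' this n
  · simp

theorem integral_powMeasure {E : Type*} [NormedAddCommGroup E] [NormedSpace ℝ E] (n : ℕ)
    (F : ℝ → E) : ∫ s, F s ∂powMeasure n = ∫ s in (0 : ℝ)..1, s ^ n • F s := by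
  rw [powMeasure, integral_withDensity_eq_integral_smul (by fun_prop),
    intervalIntegral.integral_of_le zero_le_one]
  refine setIntegral_congr_fun measurableSet_Ioc fun s hs => ?_
  simp [NNReal.smul_def, hs.1.le]

@[fun_prop]
theorem continuous_coneMap (n : ℕ) : Continuous (coneMap n) := by
  refine continuous_pi fun j => ?_
  refine Fin.lastCases ?_ (fun j => ?_) j
  · simp only [coneMap, Fin.snoc_last]
    fun_prop
  · simp only [coneMap, Fin.snoc_castSucc]
    fun_prop

instance (n : ℕ) : IsFiniteMeasure (simplexMeasure n) := by
  induction n with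
  | zero => unfold simplexMeasure; infer_instance
  | succ n _ => unfold simplexMeasure; infer_instance

theorem integrable_simplexMeasure_of_bound {E : Type*} [NormedAddCommGroup E] {n : ℕ}
    {F : (Fin (n + 1) → ℝ) → E} (hF : Continuous F) {C : ℝ} (hC : ∀ u, ‖F u‖ ≤ C) :
    Integrable F (simplexMeasure n) :=
  (integrable_const C).mono' hF.aestronglyMeasurable (.of_forall hC)

/-- The slice of the simplex with last coordinate `1 - s` is an `s`-scaled simplex, whence the
weight `s ^ n`. The recursion has the same shape as the rescaled Duhamel integral. -/
theorem integral_simplexMeasure_succ {E : Type*} [NormedAddCommGroup E] [NormedSpace ℝ E]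
    {n : ℕ} {F : (Fin (n + 2) → ℝ) → E} (hF : Continuous F) {C : ℝ} (hC : ∀ u, ‖F u‖ ≤ C) :
    ∫ u, F u ∂simplexMeasure (n + 1) =
      ∫ s in (0 : ℝ)..1, s ^ n • ∫ u, F (coneMap n (s, u)) ∂simplexMeasure n := by
  rw [simplexMeasure, integral_map (by fun_prop) hF.aestronglyMeasurable, integral_prod,
    integral_powMeasure]
  exact (integrable_const C).mono' (hF.comp (continuous_coneMap n)).aestronglyMeasurable
    (.of_forall fun p => hC _)

theorem simplexMeasure_ae (n : ℕ) : ∀ᵐ u ∂simplexMeasure n, ∀ j, |u j| ≤ 1 := by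
  induction n with
  | zero =>
    rw [simplexMeasure, ae_dirac_iff]
    · simp
    · measurability
  | succ n ih =>
    rw [simplexMeasure, ae_map_iff (by fun_prop) (by measurability)]
    have h1 : ∀ᵐ p ∂(powMeasure n).prod (simplexMeasure n), p.1 ∈ Set.Ioc (0 : ℝ) 1 :=
      Measure.quasiMeasurePreserving_fst.ae (powMeasure_ae n)
    have h2 : ∀ᵐ p ∂(powMeasure n).prod (simplexMeasure n), ∀ j, |p.2 j| ≤ 1 :=
      Measure.quasiMeasurePreserving_snd.ae ih
    filter_upwards [h1, h2] with p hp1 hp2 j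
    refine Fin.lastCases ?_ (fun j => ?_) j
    · simp only [coneMap, Fin.snoc_last]
      rw [abs_le]
      constructor <;> linarith [hp1.1, hp1.2]
    · simp only [coneMap, Fin.snoc_castSucc, Pi.smul_apply, smul_eq_mul, abs_mul]
      exact mul_le_one₀ (by rw [abs_of_pos hp1.1]; exact hp1.2) (abs_nonneg _) (hp2 j)

theorem sum_coneMap_mul {n : ℕ} (s : ℝ) (u : Fin (n + 1) → ℝ) (x : Fin (n + 2) → ℝ) :
    ∑ j, coneMap n (s, u) j * x j =
      s * ∑ j, u j * Fin.init x j + (1 - s) * x (Fin.last (n + 1)) := by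
  rw [Fin.sum_univ_castSucc, Finset.mul_sum]
  simp [coneMap, Fin.init, mul_assoc]

end Simplex

/-! ### Divided differences of exponentials -/

section DivDiff

theorem divDiffRec_const_mul (c : ℂ) (g : ℝ → ℂ) :
    ∀ (n : ℕ) (x : Fin (n + 1) → ℝ),
      divDiffRec (fun y => c * g y) n x = c * divDiffRec g n x
  | 0, _ => rfl
  | n + 1, _ => by
    simp only [divDiffRec]
    rw [divDiffRec_const_mul c g n, divDiffRec_const_mul c g n]
    ring

theorem divDiffRec_const_succ (c : ℂ) :
    ∀ (n : ℕ) (x : Fin (n + 2) → ℝ), divDiffRec (fun _ => c) (n + 1) x = 0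
  | 0, _ => by simp [divDiffRec]
  | n + 1, _ => by
    rw [divDiffRec, divDiffRec_const_succ c n, divDiffRec_const_succ c n]
    simp

theorem hasDerivAt_divDiffRec {g g' : ℝ → ℝ → ℂ} {t : ℝ}
    (h : ∀ y, HasDerivAt (fun s => g s y) (g' t y) t) :
    ∀ (n : ℕ) (x : Fin (n + 1) → ℝ),
      HasDerivAt (fun s => divDiffRec (g s) n x) (divDiffRec (g' t) n x) t
  | 0, _ => h _
  | n + 1, _ =>
    ((hasDerivAt_divDiffRec h n _).sub (hasDerivAt_divDiffRec h n _)).div_const _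

/-- The Leibniz rule for the multiplication by the coordinate function. -/
theorem divDiffRec_mul_left (g : ℝ → ℂ) :
    ∀ (n : ℕ) (x : Fin (n + 2) → ℝ), Function.Injective x →
      divDiffRec (fun y => (y : ℂ) * g y) (n + 1) x =
        (x (Fin.last (n + 1)) : ℂ) * divDiffRec g (n + 1) x + divDiffRec g n (Fin.init x) := by
  intro n
  induction n with
  | zero =>
    intro x hx
    have h01 : ((x 0 - x 1 : ℝ) : ℂ) ≠ 0 := by
      rw [Complex.ofReal_ne_zero, sub_ne_zero]
      exact hx.ne (by simp)
    have h01' : (x 0 - x 1 : ℂ) ≠ 0 := by exact_mod_cast h01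
    simp only [divDiffRec, Fin.init, Fin.tail, Fin.last, Fin.castSucc_zero, zero_add,
      Fin.succ_zero_eq_one, Fin.mk_one]
    push_cast
    field_simp
    ring
  | succ n ih =>
    intro x hx
    have hi : Function.Injective (Fin.init x) := hx.comp (Fin.castSucc_injective _)
    have ht : Function.Injective (Fin.tail x) := hx.comp (Fin.succ_injective _)
    have h0 : ((x 0 - x (Fin.last (n + 2)) : ℝ) : ℂ) ≠ 0 := by
      rw [Complex.ofReal_ne_zero, sub_ne_zero]
      exact hx.ne (Fin.last_pos).ne
    have h1 : ((Fin.init x 0 - Fin.init x (Fin.last (n + 1)) : ℝ) : ℂ) ≠ 0 := by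
      rw [Complex.ofReal_ne_zero, sub_ne_zero]
      exact hi.ne (Fin.last_pos).ne
    -- Expanding both Leibniz rules leaves two order-`n` differences; the recursion for `Fin.init
    -- x`, with its denominator cleared, is what combines them.
    have hP : divDiffRec g (n + 1) (Fin.init x) *
        ((Fin.init x 0 - Fin.init x (Fin.last (n + 1)) : ℝ) : ℂ) =
        divDiffRec g n (Fin.init (Fin.init x)) - divDiffRec g n (Fin.init (Fin.tail x)) := by
      rw [divDiffRec, div_mul_cancel₀ _ h1, Fin.tail_init_eq_init_tail]
    have hD : divDiffRec g (n + 2) x =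
        (divDiffRec g (n + 1) (Fin.init x) - divDiffRec g (n + 1) (Fin.tail x)) /
          ((x 0 - x (Fin.last (n + 2)) : ℝ) : ℂ) := rfl
    rw [divDiffRec, ih _ hi, ih _ ht, hD]
    have e0 : Fin.init x 0 = x 0 := rfl
    have e1 : Fin.tail x (Fin.last (n + 1)) = x (Fin.last (n + 2)) := rfl
    rw [e1]
    rw [e0] at hP
    push_cast at hP h0 ⊢
    field_simp
    linear_combination -hP

theorem hasDerivAt_exp_two_pi_I (y t : ℝ) :
    HasDerivAt (fun s : ℝ => Complex.exp (2 * Real.pi * Complex.I * ((s * y : ℝ) : ℂ)))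
      (2 * Real.pi * Complex.I * (y * Complex.exp (2 * Real.pi * Complex.I * ((t * y : ℝ) : ℂ))))
      t := by
  have h1 : HasDerivAt (fun s : ℝ => 2 * Real.pi * Complex.I * ((s * y : ℝ) : ℂ))
      (2 * Real.pi * Complex.I * ((1 * y : ℝ) : ℂ)) t :=
    (((hasDerivAt_id t).mul_const y).ofReal_comp).const_mul _
  convert h1.cexp using 1
  push_cast
  ring

/-- The Hermite–Genocchi formula for exponentials. -/
theorem divDiffRec_exp : ∀ (n : ℕ) (x : Fin (n + 1) → ℝ), Function.Injective x → ∀ t : ℝ,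
    divDiffRec (fun y => Complex.exp (2 * Real.pi * Complex.I * ((t * y : ℝ) : ℂ))) n x =
      (2 * Real.pi * Complex.I * t) ^ n * ∫ u, Complex.exp (2 * Real.pi * Complex.I *
        ((t * ∑ j, u j * x j : ℝ) : ℂ)) ∂simplexMeasure n := by
  intro n
  induction n with
  | zero =>
    intro x _ t
    simp [divDiffRec, simplexMeasure]
  | succ n ih =>
    intro x hx t
    have hi : Function.Injective (Fin.init x) := hx.comp (Fin.castSucc_injective _)
    let e : ℝ → ℂ := fun r => Complex.exp (2 * Real.pi * Complex.I * (r : ℂ))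
    have he_add (r s : ℝ) : e (r + s) = e r * e s := by
      simp only [e, ← Complex.exp_add, Complex.ofReal_add, mul_add]
    have he : Continuous e := by fun_prop
    let P : (k : ℕ) → (Fin (k + 1) → ℝ) → ℝ → ℂ := fun k x τ => divDiffRec (fun y => e (τ * y)) k x
    have hP (k : ℕ) (x : Fin (k + 1) → ℝ) (τ : ℝ) := hasDerivAt_divDiffRec
      (g := fun s y => e (s * y)) (g' := fun s y => 2 * Real.pi * Complex.I * (y * e (s * y)))
      (fun y => hasDerivAt_exp_two_pi_I y τ) k x
    have hPc (k : ℕ) (x : Fin (k + 1) → ℝ) : Continuous (P k x) :=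
      continuous_iff_continuousAt.2 fun τ => (hP k x τ).continuousAt
    set l := x (Fin.last (n + 1)) with hl
    -- The second factor is an integrating factor: it cancels the `l`-term of the Leibniz rule,
    -- leaving only the divided difference of order `n`.
    have hder (s : ℝ) : HasDerivAt (fun s => P (n + 1) x (s * t) * e ((1 - s) * (t * l)))
        (2 * Real.pi * Complex.I * t * (P n (Fin.init x) (s * t) * e ((1 - s) * (t * l)))) s := by
      have h1 := hP (n + 1) x (s * t)
      rw [divDiffRec_const_mul, divDiffRec_mul_left _ n x hx] at h1
      have h2 : HasDerivAt (fun s : ℝ => s * t) t s := by simpa using (hasDerivAt_id s).mul_const t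
      have h3 := h1.scomp s h2
      have h4 : HasDerivAt (fun s : ℝ => 1 - s) (-1) s := by
        simpa using (hasDerivAt_id s).const_sub 1
      have h5 := (hasDerivAt_exp_two_pi_I (t * l) (1 - s)).scomp s h4
      refine (h3.mul h5).congr_deriv ?_
      simp only [P, e, Function.comp, Complex.real_smul]
      push_cast
      ring
    have hint := intervalIntegral.integral_eq_sub_of_hasDerivAt (a := 0) (b := 1)
      (fun s _ => hder s) (by
        apply Continuous.intervalIntegrable
        have := hPc n (Fin.init x)
        fun_prop)
    -- At `s = 0` the exponential is constant, so its divided differences of positive order vanish.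
    have hz : P (n + 1) x (0 * t) = 0 := by
      have := divDiffRec_const_succ (e 0) n x
      simpa [P] using this
    have hone : e ((1 - 1) * (t * l)) = 1 := by simp [e]
    rw [hz, hone, mul_one, zero_mul, sub_zero, one_mul] at hint
    change P (n + 1) x t = _
    rw [← hint, intervalIntegral.integral_const_mul, pow_succ',
      mul_assoc (2 * Real.pi * Complex.I * (t : ℂ))]
    congr 1
    rw [integral_simplexMeasure_succ (by fun_prop) (C := 1) fun u => (norm_exp_two_pi_I _).le,
      ← intervalIntegral.integral_const_mul]
    refine intervalIntegral.integral_congr fun s _ => ?_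
    simp only [P, e]
    rw [ih _ hi]
    have hsplit (u : Fin (n + 1) → ℝ) : e (t * ∑ j, coneMap n (s, u) j * x j) =
        e (s * t * ∑ j, u j * Fin.init x j) * e ((1 - s) * (t * l)) := by
      rw [sum_coneMap_mul, ← he_add]
      congr 1
      ring
    simp only [e] at hsplit
    simp only [hsplit, integral_mul_const, Complex.real_smul]
    push_cast
    ring

end DivDiff

/-! ### The Duhamel expansion of the exponential of a sum -/

section Duhamel

variable {𝔸 : Type*} [NormedRing 𝔸] [NormedAlgebra ℝ 𝔸]

/-- The Duhamel operator `g ↦ (t ↦ ∫₀ᵗ g(s) y e^{(t - s) x} ds)`, with the integral rescaled to the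
unit interval. -/
def duhamel (x y : 𝔸) (g : ℝ → 𝔸) (t : ℝ) : 𝔸 :=
  t • ∫ s in (0 : ℝ)..1, g (s * t) * y * NormedSpace.exp (((1 - s) * t) • x)

theorem duhamel_smul_right (x y : 𝔸) (c : ℝ) (g : ℝ → 𝔸) :
    duhamel x (c • y) g = c • duhamel x y g := by
  funext t
  simp only [duhamel, Pi.smul_apply, mul_smul_comm, smul_mul_assoc, intervalIntegral.integral_smul]
  rw [smul_comm]

theorem duhamel_smul (x y : 𝔸) (c : ℝ) (g : ℝ → 𝔸) :
    duhamel x y (c • g) = c • duhamel x y g := by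
  funext t
  simp only [duhamel, Pi.smul_apply, smul_mul_assoc, intervalIntegral.integral_smul]
  rw [smul_comm]

theorem iterate_duhamel_smul_right (x y : 𝔸) (c : ℝ) (g : ℝ → 𝔸) (n : ℕ) :
    (duhamel x (c • y))^[n] g = c ^ n • (duhamel x y)^[n] g := by
  induction n with
  | zero => simp
  | succ n ih =>
    simp only [Function.iterate_succ_apply']
    rw [ih, duhamel_smul_right, duhamel_smul, smul_smul, pow_succ']

/-- Each iteration contributes `∫₀¹ sⁿ ds = 1 / (n + 1)`, which builds the factorial. Bounds on `|t|
≤ T` suffice because `s * t` and `(1 - s) * t` stay in that range; this covers non-unitary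
exponentials too. -/
theorem norm_iterate_duhamel_le (x y : 𝔸) {g : ℝ → 𝔸} {T K L : ℝ}
    (hg : ∀ t, |t| ≤ T → ‖g t‖ ≤ K) (hK : 0 ≤ K) (hL : 0 ≤ L)
    (hx : ∀ t : ℝ, |t| ≤ T → ‖NormedSpace.exp (t • x)‖ ≤ L) (n : ℕ) :
    ∀ t, |t| ≤ T → ‖(duhamel x y)^[n] g t‖ ≤ K * (L * ‖y‖ * |t|) ^ n / n.factorial := by
  induction n with
  | zero => intro t ht; simpa using hg t ht
  | succ n ih =>
    intro t ht
    rw [Function.iterate_succ_apply', duhamel, norm_smul, Real.norm_eq_abs]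
    have hI : ‖∫ s in (0 : ℝ)..1, (duhamel x y)^[n] g (s * t) * y *
        NormedSpace.exp (((1 - s) * t) • x)‖ ≤
        ∫ s in (0 : ℝ)..1, s ^ n * (K * (L * ‖y‖ * |t|) ^ n / n.factorial * ‖y‖ * L) := by
      refine intervalIntegral.norm_integral_le_of_norm_le zero_le_one
        (.of_forall fun s hs => ?_) (by
          apply Continuous.intervalIntegrable
          fun_prop)
      have hst : |s * t| ≤ T := by
        rw [abs_mul, abs_of_pos hs.1]
        exact (mul_le_of_le_one_left (abs_nonneg _) hs.2).trans ht
      have hst' : |(1 - s) * t| ≤ T := by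
        rw [abs_mul, abs_of_nonneg (sub_nonneg.2 hs.2)]
        exact (mul_le_of_le_one_left (abs_nonneg _) (by linarith [hs.1])).trans ht
      have h1 := ih _ hst
      rw [abs_mul, abs_of_pos hs.1] at h1
      calc _ ≤ ‖(duhamel x y)^[n] g (s * t)‖ * ‖y‖ * ‖NormedSpace.exp (((1 - s) * t) • x)‖ :=
            (norm_mul_le _ _).trans (by gcongr; exact norm_mul_le _ _)
        _ ≤ K * (L * ‖y‖ * (s * |t|)) ^ n / n.factorial * ‖y‖ * L := by
            have hnn : 0 ≤ K * (L * ‖y‖ * (s * |t|)) ^ n / n.factorial := by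
              have := hs.1.le
              positivity
            gcongr
            exact hx _ hst'
        _ = _ := by
            rw [show L * ‖y‖ * (s * |t|) = s * (L * ‖y‖ * |t|) by ring, mul_pow]
            ring
    rw [intervalIntegral.integral_mul_const, integral_pow] at hI
    calc _ ≤ |t| * _ := mul_le_mul_of_nonneg_left hI (abs_nonneg _)
      _ = _ := by
        rw [Nat.factorial_succ]
        push_cast
        have : (n.factorial : ℝ) ≠ 0 := by positivity
        field_simp
        rw [pow_succ]
        ring

variable [CompleteSpace 𝔸]

@[fun_prop]
theorem continuous_exp_smul (x : 𝔸) : Continuous fun t : ℝ => NormedSpace.exp (t • x) :=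
  continuous_iff_continuousAt.2 fun t => (hasDerivAt_exp_smul_const x t).continuousAt

theorem continuous_duhamel_integrand (x y : 𝔸) {g : ℝ → 𝔸} (hg : Continuous g) (t : ℝ) :
    Continuous fun s : ℝ => g (s * t) * y * NormedSpace.exp (((1 - s) * t) • x) :=
  ((hg.comp (by fun_prop)).mul continuous_const).mul ((continuous_exp_smul x).comp (by fun_prop))

theorem continuous_duhamel (x y : 𝔸) {g : ℝ → 𝔸} (hg : Continuous g) :
    Continuous (duhamel x y g) := by
  refine continuous_id.smul ?_
  apply intervalIntegral.continuous_parametric_intervalIntegral_of_continuous'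
  have := continuous_exp_smul x
  simp only [Function.uncurry_def]
  exact ((hg.comp (by fun_prop)).mul continuous_const).mul (this.comp (by fun_prop))

theorem continuous_iterate_duhamel (x y : 𝔸) {g : ℝ → 𝔸} (hg : Continuous g) (n : ℕ) :
    Continuous ((duhamel x y)^[n] g) := by
  induction n with
  | zero => exact hg
  | succ n ih =>
    rw [Function.iterate_succ_apply']
    exact continuous_duhamel x y ih

theorem duhamel_add (x y : 𝔸) {g h : ℝ → 𝔸} (hg : Continuous g) (hh : Continuous h) :
    duhamel x y (g + h) = duhamel x y g + duhamel x y h := by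
  funext t
  simp only [duhamel, Pi.add_apply, add_mul]
  rw [intervalIntegral.integral_add, smul_add]
  · exact (continuous_duhamel_integrand x y hg t).intervalIntegrable _ _
  · exact (continuous_duhamel_integrand x y hh t).intervalIntegrable _ _

theorem iterate_duhamel_add (x y : 𝔸) {g h : ℝ → 𝔸} (hg : Continuous g) (hh : Continuous h)
    (n : ℕ) :
    (duhamel x y)^[n] (g + h) = (duhamel x y)^[n] g + (duhamel x y)^[n] h := by
  induction n with
  | zero => rfl
  | succ n ih =>
    simp only [Function.iterate_succ_apply']
    rw [ih, duhamel_add x y (continuous_iterate_duhamel x y hg n)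
      (continuous_iterate_duhamel x y hh n)]

/-- The fundamental theorem of calculus for `s ↦ e^{st(x+y)} e^{(1-s)tx}` on the unit interval: in
the derivative the `x`-terms cancel. -/
theorem exp_add_eq_duhamel (x y : 𝔸) :
    (fun t : ℝ => NormedSpace.exp (t • (x + y))) =
      (fun t : ℝ => NormedSpace.exp (t • x)) +
        duhamel x y fun t => NormedSpace.exp (t • (x + y)) := by
  funext t
  have hder (s : ℝ) : HasDerivAt
      (fun s : ℝ => NormedSpace.exp ((s * t) • (x + y)) * NormedSpace.exp (((1 - s) * t) • x))
      (t • (NormedSpace.exp ((s * t) • (x + y)) * y * NormedSpace.exp (((1 - s) * t) • x))) s := by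
    have h1 : HasDerivAt (fun s : ℝ => s * t) t s := by simpa using (hasDerivAt_id s).mul_const t
    have h2 : HasDerivAt (fun s : ℝ => (1 - s) * t) (-t) s := by
      simpa using ((hasDerivAt_id s).const_sub 1).mul_const t
    have h3 := (hasDerivAt_exp_smul_const (x + y) (s * t)).scomp s h1
    have h4 := (hasDerivAt_exp_smul_const' x ((1 - s) * t)).scomp s h2
    refine (h3.mul h4).congr_deriv ?_
    simp only [Function.comp, mul_add, neg_smul, smul_mul_assoc, mul_neg, mul_smul_comm, add_mul,
      smul_add, mul_assoc]
    abel
  have hint := intervalIntegral.integral_eq_sub_of_hasDerivAt (a := 0) (b := 1)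
    (fun s _ => hder s) (by
      apply Continuous.intervalIntegrable
      exact (continuous_duhamel_integrand x y (continuous_exp_smul (x + y)) t).const_smul t)
  rw [intervalIntegral.integral_smul] at hint
  simp only [one_mul, sub_self, zero_mul, zero_smul, NormedSpace.exp_zero, mul_one, sub_zero]
    at hint
  simp only [Pi.add_apply, duhamel, hint]
  abel

/-- The Duhamel expansion with remainder. -/
theorem exp_add_eq_sum_duhamel (x y : 𝔸) (N : ℕ) :
    (fun t : ℝ => NormedSpace.exp (t • (x + y))) =
      (∑ n ∈ Finset.range N, (duhamel x y)^[n] fun t : ℝ => NormedSpace.exp (t • x)) +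
        (duhamel x y)^[N] fun t => NormedSpace.exp (t • (x + y)) := by
  induction N with
  | zero => simp
  | succ N ih =>
    conv_lhs => rw [ih]
    rw [Finset.sum_range_succ, add_assoc, Function.iterate_succ_apply]
    congr 1
    -- The one-step identity is substituted inside the `N`-th iterate, so additivity splits off
    -- exactly the `N`-th term.
    conv_lhs => rw [exp_add_eq_duhamel x y]
    exact iterate_duhamel_add x y (continuous_exp_smul x)
      (continuous_duhamel x y (continuous_exp_smul _)) N

end Duhamel

/-! ### The contraction as a multilinear map -/

section Contract

variable {A : Type*} [CStarAlgebra A]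

/-- The contraction with `b₁, …, bₙ` as a continuous linear map. -/
def contractL {n : ℕ} (b : Fin n → A) : ProjTensor A (n + 1) →L[ℂ] A :=
  (mulMap A (n + 1)).comp (mulRightElem (Fin.snoc (α := fun _ => A) b 1))

theorem contractL_apply {n : ℕ} (b : Fin n → A) (x : ProjTensor A (n + 1)) :
    contractL b x = contract x b := rfl

variable (A) in
/-- The elementary tensors as a continuous multilinear map. -/
def elemTensorL (m : ℕ) : ContinuousMultilinearMap ℂ (fun _ : Fin m => A) (ProjTensor A m) :=
  (UniformSpace.Completion.toComplL : (⨂[ℂ] _ : Fin m, A) →L[ℂ] _).compContinuousMultilinearMap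
    (PiTensorProduct.tprodL ℂ)

theorem elemTensorL_apply {m : ℕ} (c : Fin m → A) : elemTensorL A m c = elemTensor c := by
  simp [elemTensorL, elemTensor]

/-- The multilinear map `(a₀, …, aₙ) ↦ a₀ b a₁ b ⋯ b aₙ`. -/
def interlace (n : ℕ) (b : A) : ContinuousMultilinearMap ℂ (fun _ : Fin (n + 1) => A) A :=
  (contractL fun _ : Fin n => b).compContinuousMultilinearMap (elemTensorL A (n + 1))

theorem interlace_apply_eq_contract {n : ℕ} (b : A) (c : Fin (n + 1) → A) :
    interlace n b c = contract (elemTensor c) fun _ => b := by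
  simp [interlace, elemTensorL_apply, contractL_apply]

theorem interlace_zero (b : A) (c : Fin 1 → A) : interlace 0 b c = c 0 := by
  rw [interlace_apply_eq_contract, contract_elemTensor]
  simp

theorem interlace_succ {n : ℕ} (b : A) (c : Fin (n + 2) → A) :
    interlace (n + 1) b c = interlace n b (Fin.init c) * b * c (Fin.last (n + 1)) := by
  simp only [interlace_apply_eq_contract, contract_elemTensor]
  rw [List.ofFn_succ', List.concat_eq_append, List.prod_append]
  simp [Fin.init, mul_assoc]

theorem expI_eq_exp_smul (a : A) (t : ℝ) :
    expI a t = NormedSpace.exp (t • ((2 * Real.pi * Complex.I : ℂ) • a)) := by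
  rw [expI, ← Complex.coe_smul, smul_smul, mul_comm]

/-- The terms of the Duhamel expansion as integrals over simplices. -/
theorem iterate_duhamel_eq_integral {a : A} (ha : IsSelfAdjoint a) (b : A) (n : ℕ) : ∀ t : ℝ,
    (duhamel ((2 * Real.pi * Complex.I : ℂ) • a) ((2 * Real.pi * Complex.I : ℂ) • b))^[n]
      (expI a) t = (2 * Real.pi * Complex.I * t) ^ n •
        ∫ u, interlace n b (fun j => expI a (t * u j)) ∂simplexMeasure n := by
  induction n with
  | zero =>
    intro t
    simp [interlace_zero, simplexMeasure]
  | succ n ih =>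
    intro t
    rw [Function.iterate_succ_apply', duhamel, integral_simplexMeasure_succ
      (F := fun u => interlace (n + 1) b fun j => expI a (t * u j))
      ((continuous_multilinear_expI (interlace (n + 1) b) a).comp (by fun_prop))
      fun u => norm_multilinear_expI_le _ ha _, ← Complex.coe_smul t, ← intervalIntegral.integral_smul,
      ← intervalIntegral.integral_smul]
    refine intervalIntegral.integral_congr fun s _ => ?_
    simp only [ih]
    -- The last cone coordinate `1 - s` yields the factor that the Duhamel operator appends on the
    -- right; the others rescale `t` to `s * t`.
    have hsplit (u : Fin (n + 1) → ℝ) :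
        interlace (n + 1) b (fun j => expI a (t * coneMap n (s, u) j)) =
          interlace n b (fun j => expI a (s * t * u j)) * (b * expI a ((1 - s) * t)) := by
      rw [interlace_succ, mul_assoc]
      simp only [coneMap, Fin.snoc_last, Fin.init_def, Fin.snoc_castSucc, Pi.smul_apply, smul_eq_mul]
      ring_nf
    have hint : Integrable (fun u => interlace n b fun j => expI a (s * t * u j))
        (simplexMeasure n) :=
      integrable_simplexMeasure_of_bound
        ((continuous_multilinear_expI (interlace n b) a).comp (by fun_prop))
        fun u => norm_multilinear_expI_le _ ha _
    simp only [hsplit]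
    rw [integral_mul_const_of_integrable hint, ← expI_eq_exp_smul, ← Complex.coe_smul (s ^ n)]
    simp only [smul_mul_assoc, mul_smul_comm, smul_smul, mul_assoc]
    congr 1
    push_cast
    ring

end Contract

/-! ### Cutoff functions -/

section Cutoff

/-- A smooth compactly supported cutoff function around a compact subset of the line. -/
theorem exists_schwartz_cutoff {K V : Set ℝ} (hK : IsCompact K) (hV : IsOpen V) (hKV : K ⊆ V) :
    ∃ χ : 𝓢(ℝ, ℂ), HasCompactSupport χ ∧ tsupport χ ⊆ V ∧ ∃ W, IsOpen W ∧ K ⊆ W ∧ W ⊆ V ∧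
      ∀ x ∈ W, χ x = 1 := by
  obtain ⟨L, hL, hKL, hLV⟩ := exists_compact_between hK hV hKV
  obtain ⟨f, hf1, hf0, -⟩ := exists_contMDiffMap_one_nhds_of_subset_interior (n := ⊤)
    (modelWithCornersSelf ℝ ℝ) hK.isClosed hKL
  have hfs : ContDiff ℝ ∞ fun x => (f x : ℂ) :=
    Complex.ofRealCLM.contDiff.comp (contMDiff_iff_contDiff.1 f.contMDiff)
  have hsub : Function.support (fun x => (f x : ℂ)) ⊆ L := fun x hx => by
    by_contra hxL
    exact hx (by simp [hf0 x hxL])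
  have hts : tsupport (fun x => (f x : ℂ)) ⊆ L := closure_minimal hsub hL.isClosed
  have hcs : HasCompactSupport fun x => (f x : ℂ) := hL.of_isClosed_subset (isClosed_tsupport _) hts
  obtain ⟨W, hW, hKW, hWf⟩ := mem_nhdsSet_iff_exists.1 hf1
  refine ⟨hcs.toSchwartzMap hfs, hcs, hts.trans hLV, W ∩ interior L, hW.inter isOpen_interior,
    Set.subset_inter hKW hKL, Set.inter_subset_right.trans (interior_subset.trans hLV),
    fun x hx => ?_⟩
  have : f x = 1 := hWf hx.1
  simp [this]

theorem exists_schwartz_eqOn {K U : Set ℝ} (hK : IsCompact K) (hU : IsOpen U) (hKU : K ⊆ U)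
    {f : ℝ → ℂ} (hf : ContDiffOn ℝ ∞ f U) :
    ∃ ψ : 𝓢(ℝ, ℂ), ∃ V, IsOpen V ∧ K ⊆ V ∧ V ⊆ U ∧ ∀ x ∈ V, f x = ψ x := by
  obtain ⟨χ, hcs, hts, V, hV, hKV, hVU, h1⟩ := exists_schwartz_cutoff hK hU hKU
  have hsmooth : ContDiff ℝ ∞ fun x => χ x * f x := by
    refine contDiff_iff_contDiffAt.2 fun x => ?_
    by_cases hx : x ∈ tsupport χ
    · exact χ.smooth'.contDiffAt.mul (hf.contDiffAt (hU.mem_nhds (hts hx)))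
    · refine contDiffAt_const (c := (0 : ℂ)) |>.congr_of_eventuallyEq ?_
      filter_upwards [(isClosed_tsupport χ).isOpen_compl.mem_nhds hx] with y hy
      simp [image_eq_zero_of_notMem_tsupport hy]
  refine ⟨(hcs.mul_right (f' := f)).toSchwartzMap hsmooth, V, hV, hKV, hVU, fun x hx => ?_⟩
  simp [h1 x hx]

/-- A tube lemma, through thickenings in the sup metric. A product neighborhood is needed because
the cutoff used later is a product of one-variable cutoffs. -/
theorem exists_open_forall_mem {m : ℕ} {K : Set ℝ} (hK : IsCompact K)
    {S : Set (EuclideanSpace ℝ (Fin m))}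
    (hS : S ∈ 𝓝ˢ {x : EuclideanSpace ℝ (Fin m) | ∀ j, x j ∈ K}) :
    ∃ V, IsOpen V ∧ K ⊆ V ∧ ∀ x : EuclideanSpace ℝ (Fin m), (∀ j, x j ∈ V) → x ∈ S := by
  obtain ⟨T, hT, hKT, hTS⟩ := mem_nhdsSet_iff_exists.1 hS
  have hT' : IsOpen ((WithLp.toLp 2 : (Fin m → ℝ) → EuclideanSpace ℝ (Fin m)) ⁻¹' T) :=
    hT.preimage (PiLp.continuous_toLp 2 _)
  obtain ⟨δ, hδ, hsub⟩ := (isCompact_univ_pi fun _ : Fin m => hK).exists_thickening_subset_open hT'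
    fun x hx => hKT (by simpa using hx)
  refine ⟨Metric.thickening δ K, Metric.isOpen_thickening, Metric.self_subset_thickening hδ K,
    fun x hx => hTS ?_⟩
  simp only [Metric.mem_thickening_iff] at hx
  choose k hk hd using hx
  have : x.ofLp ∈ Metric.thickening δ (Set.univ.pi fun _ : Fin m => K) :=
    Metric.mem_thickening_iff.2 ⟨k, fun j _ => hk j, (dist_pi_lt_iff hδ).2 hd⟩
  exact hsub this

end Cutoff

/-! ### The divided differences of a Schwartz function -/

section DivDiff

theorem divDiffRec_congr {f g : ℝ → ℂ} : ∀ (n : ℕ) (x : Fin (n + 1) → ℝ),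
    (∀ j, f (x j) = g (x j)) → divDiffRec f n x = divDiffRec g n x
  | 0, _, h => h 0
  | n + 1, x, h => by
    rw [divDiffRec, divDiffRec, divDiffRec_congr n (Fin.init x) fun j => h j.castSucc,
      divDiffRec_congr n (Fin.tail x) fun j => h j.succ]

/-- The perturbed points `x j + ε * j` are pairwise distinct for small `ε ≠ 0`. This density makes
the extension by continuity determined at every tuple. -/
theorem mem_closure_injective {m : ℕ} (x : Fin m → ℝ) :
    x ∈ closure {y : Fin m → ℝ | Function.Injective y} := by
  have hlim : Filter.Tendsto (fun ε : ℝ => fun j : Fin m => x j + ε * (j : ℝ)) (𝓝[≠] 0) (𝓝 x) := by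
    have : Continuous fun ε : ℝ => fun j : Fin m => x j + ε * (j : ℝ) := by fun_prop
    have h := this.tendsto 0
    simp only [zero_mul, add_zero] at h
    exact h.mono_left nhdsWithin_le_nhds
  refine mem_closure_of_tendsto hlim ?_
  have hpair (i j : Fin m) (hij : i ≠ j) :
      ∀ᶠ ε : ℝ in 𝓝[≠] 0, x i + ε * (i : ℝ) ≠ x j + ε * (j : ℝ) := by
    by_cases hx : x i = x j
    · filter_upwards [self_mem_nhdsWithin] with ε hε h
      rw [hx] at h
      have := mul_left_cancel₀ hε (add_left_cancel h)
      exact hij (Fin.ext (by exact_mod_cast this))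
    · have hc : ContinuousAt (fun ε : ℝ => (x i + ε * (i : ℝ)) - (x j + ε * (j : ℝ))) 0 := by
        fun_prop
      have := hc.eventually_ne (y := 0) (by simpa [sub_eq_zero] using hx)
      filter_upwards [nhdsWithin_le_nhds this] with ε h
      exact sub_ne_zero.1 h
  have hall : ∀ᶠ ε : ℝ in 𝓝[≠] 0, ∀ i j : Fin m, i ≠ j →
      x i + ε * (i : ℝ) ≠ x j + ε * (j : ℝ) := by
    simp only [Filter.eventually_all]
    exact hpair
  filter_upwards [hall] with ε h i j hij
  by_contra hne
  exact h i j hne hij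

/-- The Fourier density of the `n`-th derivative of a Schwartz function. -/
def derivDensity (ψ : 𝓢(ℝ, ℂ)) (n : ℕ) (ξ : ℝ) : ℂ :=
  (𝓕 ψ) ξ * (2 * Real.pi * Complex.I * ξ) ^ n

@[fun_prop]
theorem continuous_derivDensity (ψ : 𝓢(ℝ, ℂ)) (n : ℕ) : Continuous (derivDensity ψ n) := by
  have : Continuous (𝓕 ψ : 𝓢(ℝ, ℂ)) := (𝓕 ψ).continuous
  unfold derivDensity
  fun_prop

theorem integrable_pow_mul_derivDensity (ψ : 𝓢(ℝ, ℂ)) (n k : ℕ) :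
    Integrable fun ξ => |ξ| ^ k * ‖derivDensity ψ n ξ‖ := by
  have := ((𝓕 ψ).integrable_pow_mul volume (k + n)).const_mul ((2 * Real.pi) ^ n)
  refine this.congr (.of_forall fun ξ => ?_)
  simp only [derivDensity, norm_mul, norm_pow, Complex.norm_real, Complex.norm_I, Complex.norm_ofNat,
    Real.norm_eq_abs, abs_of_pos Real.pi_pos]
  ring

theorem integrable_derivDensity (ψ : 𝓢(ℝ, ℂ)) (n : ℕ) : Integrable (derivDensity ψ n) := by
  have := integrable_pow_mul_derivDensity ψ n 0
  simp only [pow_zero, one_mul] at this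
  exact (integrable_norm_iff (continuous_derivDensity ψ n).aestronglyMeasurable).1 this

/-- The divided difference of a Schwartz function, as a superposition of exponentials. -/
def divDiffSymbol (ψ : 𝓢(ℝ, ℂ)) (n : ℕ) (x : Fin (n + 1) → ℝ) : ℂ :=
  ∫ p : ℝ × (Fin (n + 1) → ℝ), derivDensity ψ n p.1 *
    Complex.exp (2 * Real.pi * Complex.I * ((∑ j, p.1 * p.2 j * x j : ℝ) : ℂ))
    ∂(volume.prod (simplexMeasure n))

/-- Fourier inversion at each node, propagated by linearity of the recursion. Integrability is
proved alongside so that the integral of a difference splits. -/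
theorem integrable_divDiffRec_exp (ψ : 𝓢(ℝ, ℂ)) : ∀ (n : ℕ) (x : Fin (n + 1) → ℝ),
    Integrable (fun ξ : ℝ => (𝓕 ψ) ξ *
      divDiffRec (fun y => Complex.exp (2 * Real.pi * Complex.I * ((ξ * y : ℝ) : ℂ))) n x) ∧
    divDiffRec ψ n x = ∫ ξ : ℝ, (𝓕 ψ) ξ *
      divDiffRec (fun y => Complex.exp (2 * Real.pi * Complex.I * ((ξ * y : ℝ) : ℂ))) n x
  | 0, x => by
    have hc : Continuous (𝓕 ψ : 𝓢(ℝ, ℂ)) := (𝓕 ψ).continuous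
    simp only [divDiffRec]
    constructor
    · refine (𝓕 ψ).integrable.norm.mono' (by fun_prop) (.of_forall fun ξ => ?_)
      rw [norm_mul, norm_exp_two_pi_I, mul_one]
    · rw [← integral_fourier_mul_exp ψ (x 0)]
      simp only [Complex.ofReal_mul, mul_assoc]
  | n + 1, x => by
    obtain ⟨h1, e1⟩ := integrable_divDiffRec_exp ψ n (Fin.init x)
    obtain ⟨h2, e2⟩ := integrable_divDiffRec_exp ψ n (Fin.tail x)
    simp only [divDiffRec, ← mul_div_assoc, mul_sub]
    exact ⟨(h1.sub h2).div_const _, by rw [integral_div, integral_sub h1 h2, e1, e2]⟩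

theorem divDiffRec_eq_symbol (ψ : 𝓢(ℝ, ℂ)) (n : ℕ) {x : Fin (n + 1) → ℝ}
    (hx : Function.Injective x) : divDiffRec ψ n x = divDiffSymbol ψ n x := by
  rw [(integrable_divDiffRec_exp ψ n x).2, divDiffSymbol, integral_prod]
  · refine integral_congr_ae (.of_forall fun ξ => ?_)
    simp only
    rw [divDiffRec_exp n x hx, ← mul_assoc, integral_const_mul, derivDensity]
    simp only [Finset.mul_sum, mul_assoc]
  · refine ((integrable_derivDensity ψ n).comp_fst (simplexMeasure n)).norm.mono' ?_
      (.of_forall fun p => ?_)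
    · apply Continuous.aestronglyMeasurable
      fun_prop
    · rw [norm_mul, norm_exp_two_pi_I, mul_one]

/-- The symbol is a Fourier integral over the frequencies `ξ • u`. Since `|u j| ≤ 1` almost
everywhere on the simplex, all its moments are controlled by those of `derivDensity ψ n`. -/
theorem contDiff_divDiffSymbol (ψ : 𝓢(ℝ, ℂ)) (n : ℕ) : ContDiff ℝ ∞ (divDiffSymbol ψ n) := by
  let L : ((Fin (n + 1) → ℝ) × ℝ) →L[ℝ] (Fin (n + 1) → ℝ) →L[ℝ] ℝ :=
    ∑ j, ((ContinuousLinearMap.proj j).comp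
    (ContinuousLinearMap.fst ℝ (Fin (n + 1) → ℝ) ℝ)).smulRight
      (-(ContinuousLinearMap.proj j : (Fin (n + 1) → ℝ) →L[ℝ] ℝ))
  -- The coordinate `ξ` is kept so that the density remains a function after the pushforward. The
  -- minus sign in `L` undoes the one in the Fourier kernel.
  let T : ℝ × (Fin (n + 1) → ℝ) → ((Fin (n + 1) → ℝ) × ℝ) := fun p => (p.1 • p.2, p.1)
  have hT : Measurable T := by
    apply Continuous.measurable
    fun_prop
  let μ : Measure ((Fin (n + 1) → ℝ) × ℝ) := (volume.prod (simplexMeasure n)).map T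
  let f : ((Fin (n + 1) → ℝ) × ℝ) → ℂ := fun v => derivDensity ψ n v.2
  have hf : Continuous f := by fun_prop
  have hint : ∀ k : ℕ, (k : ℕ∞) ≤ ⊤ → Integrable (fun v => ‖v‖ ^ k * ‖f v‖) μ := by
    intro k _
    rw [integrable_map_measure (by fun_prop) hT.aemeasurable]
    refine ((integrable_pow_mul_derivDensity ψ n k).comp_fst (simplexMeasure n)).mono' ?_ ?_
    · apply Measurable.aestronglyMeasurable
      exact (Continuous.measurable (by fun_prop)).comp hT
    · have hae : ∀ᵐ p ∂(volume : Measure ℝ).prod (simplexMeasure n), ∀ j, |p.2 j| ≤ 1 :=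
        Measure.quasiMeasurePreserving_snd.ae (simplexMeasure_ae n)
      filter_upwards [hae] with p hp
      have hn : ‖T p‖ ≤ |p.1| := by
        refine max_le ?_ le_rfl
        refine (pi_norm_le_iff_of_nonneg (abs_nonneg _)).2 fun j => ?_
        simp only [T, Pi.smul_apply, smul_eq_mul, Real.norm_eq_abs, abs_mul]
        exact mul_le_of_le_one_right (abs_nonneg _) (hp j)
      simp only [Function.comp, norm_mul, norm_pow, norm_norm]
      gcongr
  have key := VectorFourier.contDiff_fourierIntegral L (N := ⊤) hint
  suffices heq : divDiffSymbol ψ n = VectorFourier.fourierIntegral Real.fourierChar μ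
      (ContinuousLinearMap.toLinearMap₁₂ L) f by
    rw [heq]
    exact key
  funext x
  rw [divDiffSymbol, VectorFourier.fourierIntegral, integral_map hT.aemeasurable]
  · refine integral_congr_ae (.of_forall fun p => ?_)
    simp only [Circle.smul_def, Real.fourierChar_apply, smul_eq_mul, f, T]
    rw [mul_comm]
    congr 2
    simp [L]
    ring
  · apply Continuous.aestronglyMeasurable
    have hL : Continuous fun v : ((Fin (n + 1) → ℝ) × ℝ) => (L v) x := by fun_prop
    have : Continuous fun v : ((Fin (n + 1) → ℝ) × ℝ) => Real.fourierChar (-(L v) x) :=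
      Real.continuous_fourierChar.comp hL.neg
    exact this.smul hf

theorem divDiff_eq_symbol {f : ℝ → ℂ} {ψ : 𝓢(ℝ, ℂ)} {V : Set ℝ} (hV : IsOpen V)
    (hf : ∀ y ∈ V, f y = ψ y) {n : ℕ} {x : Fin (n + 1) → ℝ} (hx : ∀ j, x j ∈ V) :
    divDiff f n x = divDiffSymbol ψ n x := by
  refine extendFrom_eq (mem_closure_injective x) ?_
  have hc := (contDiff_divDiffSymbol ψ n).continuous.tendsto x
  refine (hc.mono_left nhdsWithin_le_nhds).congr' ?_
  have hmem : ∀ᶠ y : Fin (n + 1) → ℝ in 𝓝 x, ∀ j, y j ∈ V := by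
    simp only [Filter.eventually_all]
    exact fun j => (continuous_apply j).continuousAt.eventually (hV.mem_nhds (hx j))
  filter_upwards [nhdsWithin_le_nhds hmem, self_mem_nhdsWithin] with y hy hinj
  rw [← divDiffRec_eq_symbol ψ n hinj]
  exact (divDiffRec_congr n y fun j => hf _ (hy j)).symm

/-- A Schwartz function that agrees with the divided difference near a cube. -/
theorem exists_schwartz_eq_symbol {K : Set ℝ} (hK : IsCompact K) (ψ : 𝓢(ℝ, ℂ)) (n : ℕ) :
    ∃ φ : 𝓢(EuclideanSpace ℝ (Fin (n + 1)), ℂ), ∃ W, IsOpen W ∧ K ⊆ W ∧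
      ∀ x : EuclideanSpace ℝ (Fin (n + 1)), (∀ j, x j ∈ W) → φ x = divDiffSymbol ψ n x.ofLp := by
  obtain ⟨χ, hcs, -, W, hW, hKW, -, h1⟩ := exists_schwartz_cutoff hK isOpen_univ (Set.subset_univ K)
  let g : EuclideanSpace ℝ (Fin (n + 1)) → ℂ :=
    fun x => (∏ j, χ (x j)) * divDiffSymbol ψ n x.ofLp
  have hg : ContDiff ℝ ∞ g := by
    refine ContDiff.mul ?_ ((contDiff_divDiffSymbol ψ n).comp PiLp.contDiff_ofLp)
    refine contDiff_prod fun j _ => χ.smooth'.comp ?_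
    exact (contDiff_apply ℝ ℝ j).comp PiLp.contDiff_ofLp
  have hgc : HasCompactSupport g := by
    refine HasCompactSupport.intro ((isCompact_univ_pi fun _ : Fin (n + 1) => hcs).image
      (PiLp.continuous_toLp 2 _)) fun x hx => ?_
    have : ∃ j, x j ∉ tsupport χ := by
      by_contra! hall
      exact hx ⟨x.ofLp, fun j _ => hall j, rfl⟩
    obtain ⟨j, hj⟩ := this
    have h0 : ∏ j, χ (x j) = 0 :=
      Finset.prod_eq_zero (Finset.mem_univ j) (image_eq_zero_of_notMem_tsupport hj)
    simp [g, h0]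
  refine ⟨hgc.toSchwartzMap hg, W, hW, hKW, fun x hx => ?_⟩
  simp [g, h1 _ (hx _)]

end DivDiff

/-! ### The terms of the Taylor expansion -/

section TaylorTerm

variable {A : Type*} [CStarAlgebra A]

theorem expTensor_eq {m : ℕ} (a : A) (ξ : EuclideanSpace ℝ (Fin m)) :
    expTensor a ξ = elemTensorL A m fun j => expI a (ξ j) :=
  (elemTensorL_apply _).symm

theorem contract_schwartzCalculus {a : A} (ha : IsSelfAdjoint a) {n : ℕ}
    (φ : 𝓢(EuclideanSpace ℝ (Fin (n + 1)), ℂ)) (b : A) :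
    contract (schwartzCalculus a φ) (fun _ => b) =
      ∫ ξ : EuclideanSpace ℝ (Fin (n + 1)), (𝓕 φ) ξ • interlace n b fun j => expI a (ξ j) := by
  have hc : Continuous (𝓕 φ : 𝓢(EuclideanSpace ℝ (Fin (n + 1)), ℂ)) := (𝓕 φ).continuous
  have hint : Integrable fun ξ : EuclideanSpace ℝ (Fin (n + 1)) => (𝓕 φ) ξ • expTensor a ξ := by
    simp only [expTensor_eq]
    refine (((𝓕 φ).integrable (μ := volume)).norm.mul_const ‖elemTensorL A (n + 1)‖).mono' ?_
      (.of_forall fun ξ => ?_)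
    · exact (hc.smul ((continuous_multilinear_expI (elemTensorL A (n + 1)) a).comp
        (PiLp.continuous_ofLp 2 _))).aestronglyMeasurable
    · rw [norm_smul]
      gcongr
      exact norm_multilinear_expI_le _ ha ξ.ofLp
  rw [← contractL_apply, schwartzCalculus, ← ContinuousLinearMap.integral_comp_comm _ hint]
  refine integral_congr_ae (.of_forall fun ξ => ?_)
  simp only [map_smul, contractL_apply, interlace_apply_eq_contract]
  rfl

theorem integral_fourier_mul_exp_sum {m : ℕ} (φ : 𝓢(EuclideanSpace ℝ (Fin m), ℂ))
    (x : Fin m → ℝ) :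
    ∫ ξ : EuclideanSpace ℝ (Fin m), (𝓕 φ) ξ *
      Complex.exp (2 * Real.pi * Complex.I * ((∑ j, ξ.ofLp j * x j : ℝ) : ℂ)) =
      φ (WithLp.toLp 2 x) := by
  have h : (𝓕⁻ (𝓕 φ)) (WithLp.toLp 2 x) = φ (WithLp.toLp 2 x) := by
    rw [FourierTransform.fourierInv_fourier_eq]
  rw [← h, SchwartzMap.fourierInv_coe, Real.fourierInv_eq']
  refine integral_congr_ae (.of_forall fun t => ?_)
  simp only [smul_eq_mul]
  rw [mul_comm]
  congr 2
  simp only [PiLp.inner_apply, RCLike.inner_apply, conj_trivial]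
  push_cast
  simp only [mul_comm (t.ofLp _ : ℂ)]
  ring

theorem norm_two_pi_I_smul (b : A) : ‖(2 * Real.pi * Complex.I : ℂ) • b‖ = 2 * Real.pi * ‖b‖ := by
  simp [norm_smul, abs_of_pos Real.pi_pos]

theorem norm_iterate_duhamel_expI_le {a c : A} (ha : IsSelfAdjoint a) (hc : IsSelfAdjoint c)
    (b : A) (n : ℕ) (t : ℝ) :
    ‖(duhamel ((2 * Real.pi * Complex.I : ℂ) • a) ((2 * Real.pi * Complex.I : ℂ) • b))^[n]
      (expI c) t‖ ≤ (2 * Real.pi * ‖b‖ * |t|) ^ n / n.factorial := by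
  have := norm_iterate_duhamel_le ((2 * Real.pi * Complex.I : ℂ) • a)
    ((2 * Real.pi * Complex.I : ℂ) • b) (g := expI c) (T := |t|) (K := 1) (L := 1)
    (fun s _ => norm_expI_le hc s) zero_le_one zero_le_one
    (fun s _ => by rw [← expI_eq_exp_smul]; exact norm_expI_le ha s) n t le_rfl
  simpa only [one_mul, norm_two_pi_I_smul] using this

theorem integrable_pow_mul_fourier (ψ : 𝓢(ℝ, ℂ)) (r : ℝ) (n : ℕ) :
    Integrable fun ξ => ‖(𝓕 ψ) ξ‖ * ((r * |ξ|) ^ n / n.factorial) := by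
  have := ((𝓕 ψ).integrable_pow_mul volume n).const_mul (r ^ n / n.factorial)
  refine this.congr (.of_forall fun ξ => ?_)
  simp only [Real.norm_eq_abs, mul_pow]
  ring

theorem integrable_fourier_smul_duhamel {a c : A} (ha : IsSelfAdjoint a) (hc : IsSelfAdjoint c)
    (b : A) (ψ : 𝓢(ℝ, ℂ)) (n : ℕ) :
    Integrable fun ξ => (𝓕 ψ) ξ • (duhamel ((2 * Real.pi * Complex.I : ℂ) • a)
      ((2 * Real.pi * Complex.I : ℂ) • b))^[n] (expI c) ξ := by
  refine (integrable_pow_mul_fourier ψ (2 * Real.pi * ‖b‖) n).mono' ?_ (.of_forall fun ξ => ?_)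
  · exact ((𝓕 ψ).continuous.smul
      (continuous_iterate_duhamel _ _ (continuous_expI c) n)).aestronglyMeasurable
  · rw [norm_smul]
    gcongr
    exact norm_iterate_duhamel_expI_le ha hc b n ξ

/-- The terms of the Taylor expansion, as superpositions of the terms of the Duhamel expansion. -/
theorem taylorTerm_eq_integral {a : A} (ha : IsSelfAdjoint a) {f : ℝ → ℂ} {ψ : 𝓢(ℝ, ℂ)}
    {V : Set ℝ} (hV : IsOpen V) (haV : spectrum ℝ a ⊆ V) (hf : ∀ y ∈ V, f y = ψ y) (n : ℕ) (b : A) :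
    taylorTerm f a n b = ∫ ξ, (𝓕 ψ) ξ • (duhamel ((2 * Real.pi * Complex.I : ℂ) • a)
      ((2 * Real.pi * Complex.I : ℂ) • b))^[n] (expI a) ξ := by
  have hK : IsCompact (spectrum ℝ a) := spectrum.isCompact a
  have hex : ∃ φ : 𝓢(EuclideanSpace ℝ (Fin (n + 1)), ℂ), AgreesNearSpectrum a (divDiff f n) φ := by
    obtain ⟨φ, W, hW, hKW, hφ⟩ := exists_schwartz_eq_symbol hK ψ n
    refine ⟨φ, ?_⟩
    have hopen : IsOpen {x : EuclideanSpace ℝ (Fin (n + 1)) | ∀ j, x j ∈ W ∩ V} := by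
      simp only [Set.ofPred_forall]
      exact isOpen_iInter_of_finite fun j => (hW.inter hV).preimage (by fun_prop)
    refine Filter.mem_of_superset (hopen.mem_nhdsSet.2 fun x hx j => ⟨hKW (hx j), haV (hx j)⟩) ?_
    intro x hx
    change φ x = divDiff f n x.ofLp
    rw [hφ x fun j => (hx j).1, divDiff_eq_symbol hV hf fun j => (hx j).2]
  have hchoose := hex.choose_spec
  rw [taylorTerm, smoothCalculus, dif_pos hex, contract_schwartzCalculus ha]
  -- From here on only the agreement of `φ` with the divided difference near the spectrum is
  -- available.
  generalize hex.choose = φ at hchoose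
  obtain ⟨V', hV', hKV', hφ⟩ := exists_open_forall_mem hK hchoose
  obtain ⟨χ, -, hts, W, -, hKW, -, hχ⟩ := exists_schwartz_cutoff hK (hV'.inter hV)
    (Set.subset_inter hKV' haV)
  have hχ1 : ∀ x ∈ spectrum ℝ a, χ x = 1 := fun x hx => hχ x (hKW hx)
  have hη : Continuous fun p : ℝ × (Fin (n + 1) → ℝ) => fun j => p.1 * p.2 j := by fun_prop
  have hdens := (integrable_derivDensity ψ n).comp_fst (simplexMeasure n)
  have hright : ∫ ξ, (𝓕 ψ) ξ • (duhamel ((2 * Real.pi * Complex.I : ℂ) • a)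
      ((2 * Real.pi * Complex.I : ℂ) • b))^[n] (expI a) ξ =
      ∫ p : ℝ × (Fin (n + 1) → ℝ), derivDensity ψ n p.1 •
        interlace n b (fun j => expI a (p.1 * p.2 j)) ∂(volume.prod (simplexMeasure n)) := by
    rw [integral_prod]
    · refine integral_congr_ae (.of_forall fun ξ => ?_)
      simp only
      rw [iterate_duhamel_eq_integral ha, integral_smul, smul_smul, derivDensity]
    · refine (hdens.norm.mul_const ‖interlace n b‖).mono' ?_ (.of_forall fun p => ?_)
      · exact (((continuous_derivDensity ψ n).comp continuous_fst).smul
          ((continuous_multilinear_expI (interlace n b) a).comp hη)).aestronglyMeasurable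
      · rw [norm_smul]
        gcongr
        exact norm_multilinear_expI_le _ ha _
  rw [hright, integral_smul_multilinear_expI (interlace n b) ha hχ1 _ hdens hη.measurable,
    integral_smul_multilinear_expI (interlace n b) ha hχ1 volume
      (h := (𝓕 φ : 𝓢(EuclideanSpace ℝ (Fin (n + 1)), ℂ))) (𝓕 φ).integrable (η := WithLp.ofLp) (PiLp.continuous_ofLp 2 _).measurable]
  refine integral_congr_ae (.of_forall fun θ => ?_)
  simp only
  congr 1
  refine integral_congr_ae (.of_forall fun x => ?_)
  simp only
  congr 1
  -- On the support of the cutoff both symbols equal the divided difference of `f`; elsewhere the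
  -- cutoff kills both sides.
  by_cases hx : ∀ j, x j ∈ tsupport χ
  · congr 1
    rw [integral_fourier_mul_exp_sum φ x]
    have h1 : φ (WithLp.toLp 2 x) = divDiff f n x :=
      hφ (WithLp.toLp 2 x) fun j => (hts (hx j)).1
    rw [h1, divDiff_eq_symbol hV hf fun j => (hts (hx j)).2, divDiffSymbol]
  · push Not at hx
    obtain ⟨j, hj⟩ := hx
    rw [Finset.prod_eq_zero (Finset.mem_univ j) (image_eq_zero_of_notMem_tsupport (f := χ) hj), zero_mul,
      zero_mul]

theorem taylorTerm_smul {a : A} (ha : IsSelfAdjoint a) {f : ℝ → ℂ} {ψ : 𝓢(ℝ, ℂ)}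
    {V : Set ℝ} (hV : IsOpen V) (haV : spectrum ℝ a ⊆ V) (hf : ∀ y ∈ V, f y = ψ y) (n : ℕ)
    (t : ℝ) (b : A) : taylorTerm f a n (t • b) = t ^ n • taylorTerm f a n b := by
  rw [taylorTerm_eq_integral ha hV haV hf, taylorTerm_eq_integral ha hV haV hf, ← integral_smul]
  refine integral_congr_ae (.of_forall fun ξ => ?_)
  simp only
  rw [smul_comm _ t b, iterate_duhamel_smul_right, Pi.smul_apply, smul_comm]

/-- Taylor's formula for a Schwartz function. -/
theorem norm_cfc_sub_sum_le {a b : A} (ha : IsSelfAdjoint a) (hb : IsSelfAdjoint b)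
    (ψ : 𝓢(ℝ, ℂ)) (N : ℕ) :
    ‖cfc (fun z : ℂ => ψ z.re) (a + b) - ∑ n ∈ Finset.range N, ∫ ξ, (𝓕 ψ) ξ •
      (duhamel ((2 * Real.pi * Complex.I : ℂ) • a) ((2 * Real.pi * Complex.I : ℂ) • b))^[n]
        (expI a) ξ‖ ≤
      (∫ ξ, ‖(𝓕 ψ) ξ‖ * ((2 * Real.pi * |ξ|) ^ N / N.factorial)) * ‖b‖ ^ N := by
  have hexp (c : A) : expI c =
      fun t : ℝ => NormedSpace.exp (t • ((2 * Real.pi * Complex.I : ℂ) • c)) :=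
    funext fun t => expI_eq_exp_smul c t
  have hsum := exp_add_eq_sum_duhamel ((2 * Real.pi * Complex.I : ℂ) • a)
    ((2 * Real.pi * Complex.I : ℂ) • b) N
  rw [← smul_add, ← hexp, ← hexp] at hsum
  have hrem : cfc (fun z : ℂ => ψ z.re) (a + b) - ∑ n ∈ Finset.range N, ∫ ξ, (𝓕 ψ) ξ •
      (duhamel ((2 * Real.pi * Complex.I : ℂ) • a) ((2 * Real.pi * Complex.I : ℂ) • b))^[n]
        (expI a) ξ = ∫ ξ, (𝓕 ψ) ξ • (duhamel ((2 * Real.pi * Complex.I : ℂ) • a)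
          ((2 * Real.pi * Complex.I : ℂ) • b))^[N] (expI (a + b)) ξ := by
    rw [← integral_fourier_smul_expI (ha.add hb),
      ← integral_finsetSum _ fun n _ => integrable_fourier_smul_duhamel ha ha b ψ n,
      ← integral_sub]
    · refine integral_congr_ae (.of_forall fun ξ => ?_)
      have := congrFun hsum ξ
      simp only [Pi.add_apply, Finset.sum_apply] at this
      simp only
      rw [this, smul_add, Finset.smul_sum, add_sub_cancel_left]
    · exact integrable_fourier_smul_duhamel (ha.add hb) (ha.add hb) b ψ 0
    · exact integrable_finsetSum _ fun n _ => integrable_fourier_smul_duhamel ha ha b ψ n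
  rw [hrem, ← integral_mul_const]
  refine norm_integral_le_of_norm_le ((integrable_pow_mul_fourier ψ _ N).mul_const _)
    (.of_forall fun ξ => ?_)
  calc _ ≤ ‖(𝓕 ψ) ξ‖ * ((2 * Real.pi * ‖b‖ * |ξ|) ^ N / N.factorial) := by
        rw [norm_smul]
        gcongr
        exact norm_iterate_duhamel_expI_le ha (ha.add hb) b N ξ
    _ = _ := by
        simp only [mul_pow]
        ring

end TaylorTerm

/-! ### The Taylor expansion -/

section Expansion

variable {A : Type*} [CStarAlgebra A]

theorem eventually_spectrum_subset (a : A) {V : Set ℝ} (hV : IsOpen V) (haV : spectrum ℝ a ⊆ V) :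
    ∀ᶠ b in 𝓝[{b : A | IsSelfAdjoint b}] 0, spectrum ℝ (a + b) ⊆ V := by
  have h1 : ∀ᶠ c in 𝓝 a, V ∈ 𝓝ˢ (spectrum ℝ c) :=
    upperHemicontinuous_spectrum ℝ A a V (hV.mem_nhdsSet.2 haV)
  have h2 : Filter.Tendsto (fun b : A => a + b) (𝓝[{b : A | IsSelfAdjoint b}] 0) (𝓝 a) := by
    have : Continuous fun b : A => a + b := by fun_prop
    simpa using (this.tendsto 0).mono_left nhdsWithin_le_nhds
  filter_upwards [h2.eventually h1] with b hb
  exact hV.mem_nhdsSet.1 hb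

theorem isBigO_cfc_sub_sum_taylorTerm {a : A} (ha : IsSelfAdjoint a) {f : ℝ → ℂ} {U : Set ℝ}
    (hU : IsOpen U) (haU : spectrum ℝ a ⊆ U) (hf : ContDiffOn ℝ ∞ f U) (N : ℕ) :
    (fun b : A => cfc (fun z : ℂ => f z.re) (a + b) - ∑ n ∈ Finset.range N, taylorTerm f a n b)
      =O[𝓝[{b : A | IsSelfAdjoint b}] 0] fun b : A => ‖b‖ ^ N := by
  obtain ⟨ψ, V, hV, haV, -, hfψ⟩ := exists_schwartz_eqOn (spectrum.isCompact a) hU haU hf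
  refine Asymptotics.IsBigO.of_bound
    (∫ ξ, ‖(𝓕 ψ) ξ‖ * ((2 * Real.pi * |ξ|) ^ N / N.factorial)) ?_
  filter_upwards [eventually_spectrum_subset a hV haV, self_mem_nhdsWithin] with b hbV hb
  have hab : IsSelfAdjoint (a + b) := ha.add hb
  have hcfc : cfc (fun z : ℂ => f z.re) (a + b) = cfc (fun z : ℂ => ψ z.re) (a + b) := by
    refine cfc_congr fun z hz => hfψ _ (hbV ?_)
    rw [← spectrum.algebraMap_mem_iff ℂ]
    simpa [← hab.mem_spectrum_eq_re hz] using hz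
  rw [hcfc, norm_pow, norm_norm]
  simp only [taylorTerm_eq_integral ha hV haV hfψ]
  exact norm_cfc_sub_sum_le ha hb ψ N

/-- Uniqueness of asymptotic expansions: once the lower coefficients vanish, dividing the order-`n +
1` estimate by `t ^ n` bounds `‖v n‖` by `C * |t|`. -/
theorem eq_zero_of_isBigO_pow {E : Type*} [NormedAddCommGroup E] [NormedSpace ℝ E] {v : ℕ → E}
    (h : ∀ N : ℕ, (fun t : ℝ => ∑ n ∈ Finset.range N, t ^ n • v n) =O[𝓝 0] fun t : ℝ => t ^ N)
    (n : ℕ) : v n = 0 := by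
  induction n using Nat.strong_induction_on with
  | _ n ih =>
    obtain ⟨C, hC⟩ := (h (n + 1)).bound
    have hle : ∀ᶠ t : ℝ in 𝓝[≠] 0, ‖v n‖ ≤ C * |t| := by
      filter_upwards [nhdsWithin_le_nhds hC, self_mem_nhdsWithin] with t ht h0
      have hz : ∑ k ∈ Finset.range n, t ^ k • v k = 0 :=
        Finset.sum_eq_zero fun k hk => by rw [ih k (Finset.mem_range.1 hk), smul_zero]
      rw [Finset.sum_range_succ, hz, zero_add, norm_smul, pow_succ, norm_mul, ← mul_assoc,
        mul_comm C, mul_assoc, Real.norm_eq_abs t] at ht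
      exact le_of_mul_le_mul_left ht (norm_pos_iff.2 (pow_ne_zero _ h0))
    have hlim : Filter.Tendsto (fun t : ℝ => C * |t|) (𝓝[≠] 0) (𝓝 0) := by
      have : Continuous fun t : ℝ => C * |t| := by fun_prop
      simpa using (this.tendsto 0).mono_left nhdsWithin_le_nhds
    exact norm_le_zero_iff.1 (ge_of_tendsto hlim hle)

/-- Without the factor `2πi` the exponentials are not unitary; compactness of the parameter square
replaces unitarity. -/
theorem exists_norm_exp_smul_le (a b : A) : ∃ K : ℝ, 0 ≤ K ∧ ∀ s t : ℝ, |s| ≤ 1 → |t| ≤ 1 →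
    ‖NormedSpace.exp (s • (a + t • b))‖ ≤ K := by
  let +nondep : NormedAlgebra ℚ A := .restrictScalars ℚ ℂ A
  have hc : Continuous fun p : ℝ × ℝ => NormedSpace.exp (p.1 • (a + p.2 • b)) :=
    NormedSpace.exp_continuous.comp (by fun_prop)
  obtain ⟨K, hK⟩ := (isCompact_Icc.prod isCompact_Icc : IsCompact
    (Set.Icc (-1 : ℝ) 1 ×ˢ Set.Icc (-1 : ℝ) 1)).exists_bound_of_continuousOn hc.continuousOn
  have hK' (s t : ℝ) (hs : |s| ≤ 1) (ht : |t| ≤ 1) := hK (s, t) ⟨abs_le.1 hs, abs_le.1 ht⟩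
  exact ⟨K, (norm_nonneg _).trans (hK' 0 0 (by simp) (by simp)), hK'⟩

/-- The terms of the Duhamel expansion of `e^{a + b}`. -/
def duhamelTerm (a b : A) (n : ℕ) : A :=
  (duhamel a b)^[n] (fun t : ℝ => NormedSpace.exp (t • a)) 1

theorem duhamelTerm_smul (a b : A) (n : ℕ) (t : ℝ) :
    duhamelTerm a (t • b) n = t ^ n • duhamelTerm a b n := by
  simp only [duhamelTerm, iterate_duhamel_smul_right, Pi.smul_apply]

/-- The constants are uniform in `N` and `t`: `t = 1` with `N → ∞` gives the limit of the series,
and fixed `N` with `t → 0` the asymptotic expansion. -/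
theorem exists_norm_exp_sub_sum_le (a b : A) : ∃ K L : ℝ, 0 ≤ K ∧ 0 ≤ L ∧
    ∀ (N : ℕ) (t : ℝ), |t| ≤ 1 →
      ‖NormedSpace.exp (a + t • b) - ∑ n ∈ Finset.range N, duhamelTerm a (t • b) n‖ ≤
        K * (L * ‖b‖ * |t|) ^ N / N.factorial := by
  obtain ⟨K, hK, hb⟩ := exists_norm_exp_smul_le a b
  refine ⟨K, K, hK, hK, fun N t ht => ?_⟩
  have hsum := congrFun (exp_add_eq_sum_duhamel a (t • b) N) 1
  simp only [Pi.add_apply, Finset.sum_apply, one_smul] at hsum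
  rw [hsum]
  simp only [duhamelTerm, add_sub_cancel_left]
  have := norm_iterate_duhamel_le a (t • b) (T := 1) (K := K) (L := K)
    (fun s hs => hb s t hs ht) hK hK (fun s hs => by simpa using hb s 0 hs (by simp)) N 1 (by simp)
  refine this.trans (le_of_eq ?_)
  rw [norm_smul, Real.norm_eq_abs, abs_one]
  ring

theorem hasSum_duhamelTerm (a b : A) :
    HasSum (duhamelTerm a b) (NormedSpace.exp (a + b)) := by
  have hsummable : Summable (duhamelTerm a b) := by
    obtain ⟨K, hK, hb⟩ := exists_norm_exp_smul_le a b
    refine Summable.of_norm_bounded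
      (g := fun n => K * ((K * ‖b‖) ^ n / n.factorial))
      ((Real.summable_pow_div_factorial (K * ‖b‖)).mul_left K) fun n => ?_
    have hexp (s : ℝ) (hs : |s| ≤ 1) : ‖NormedSpace.exp (s • a)‖ ≤ K := by
      simpa using hb s 0 hs (by simp)
    have := norm_iterate_duhamel_le a b (T := 1) (K := K) (L := K) hexp hK hK hexp n 1 (by simp)
    simpa only [duhamelTerm, abs_one, mul_one, mul_div_assoc] using this
  refine (hsummable.hasSum_iff_tendsto_nat).2 ?_
  obtain ⟨K, L, -, -, h⟩ := exists_norm_exp_sub_sum_le a b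
  rw [tendsto_iff_norm_sub_tendsto_zero]
  refine squeeze_zero (fun _ => norm_nonneg _) (g := fun N => K * ((L * ‖b‖) ^ N / N.factorial))
    (fun N => ?_) ?_
  · have := h N 1 (by simp)
    rw [norm_sub_rev]
    simpa only [one_smul, abs_one, mul_one, mul_div_assoc] using this
  · simpa using (FloorSemiring.tendsto_pow_div_factorial_atTop (L * ‖b‖)).const_mul K

theorem cfc_exp_re {a : A} (ha : IsSelfAdjoint a) :
    cfc (fun z : ℂ => (Real.exp z.re : ℂ)) a = NormedSpace.exp a := by
  have hn : IsStarNormal a := ha.isStarNormal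
  rw [← CFC.complex_exp_eq_normedSpace_exp (a := a)]
  refine cfc_congr fun z hz => ?_
  rw [Complex.ofReal_exp, ← ha.mem_spectrum_eq_re hz]

/-- Both kinds of terms are homogeneous of degree `n` in `b`, so along `t • b` the two expansions of
`e^{a+tb}` are power expansions in `t`, and uniqueness of coefficients applies. -/
theorem taylorTerm_exp {a b : A} (ha : IsSelfAdjoint a) (hb : IsSelfAdjoint b) (n : ℕ) :
    taylorTerm (fun x : ℝ => (Real.exp x : ℂ)) a n b = duhamelTerm a b n := by
  set f : ℝ → ℂ := fun x => (Real.exp x : ℂ) with hfdef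
  have hf : ContDiffOn ℝ ∞ f Set.univ :=
    (Complex.ofRealCLM.contDiff.comp Real.contDiff_exp).contDiffOn
  obtain ⟨ψ, V, hV, haV, -, hfψ⟩ := exists_schwartz_eqOn (spectrum.isCompact a) isOpen_univ
    (Set.subset_univ _) hf
  have hlim : Filter.Tendsto (fun t : ℝ => t • b) (𝓝 0) (𝓝[{b : A | IsSelfAdjoint b}] 0) := by
    refine tendsto_nhdsWithin_iff.2 ⟨?_, .of_forall fun t => (IsSelfAdjoint.all t).smul hb⟩
    have : Continuous fun t : ℝ => t • b := by fun_prop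
    simpa using this.tendsto 0
  refine sub_eq_zero.1 (eq_zero_of_isBigO_pow
    (v := fun n => taylorTerm f a n b - duhamelTerm a b n) (fun N => ?_) n)
  have h1 := (isBigO_cfc_sub_sum_taylorTerm ha isOpen_univ (Set.subset_univ _) hf N).comp_tendsto
    hlim
  have h1' : (fun t : ℝ => NormedSpace.exp (a + t • b) -
      ∑ n ∈ Finset.range N, t ^ n • taylorTerm f a n b) =O[𝓝 0] fun t : ℝ => t ^ N := by
    refine (h1.congr_left fun t => ?_).trans (Asymptotics.IsBigO.of_bound (‖b‖ ^ N) ?_)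
    · simp only [Function.comp, taylorTerm_smul ha hV haV hfψ]
      rw [hfdef, cfc_exp_re (ha.add ((IsSelfAdjoint.all t).smul hb))]
    · refine .of_forall fun t => le_of_eq ?_
      simp only [Function.comp, norm_pow, norm_norm, norm_smul, norm_mul]
      ring
  have h2 : (fun t : ℝ => NormedSpace.exp (a + t • b) -
      ∑ n ∈ Finset.range N, t ^ n • duhamelTerm a b n) =O[𝓝 0] fun t : ℝ => t ^ N := by
    obtain ⟨K, L, hK, hL, h⟩ := exists_norm_exp_sub_sum_le a b
    refine Asymptotics.IsBigO.of_bound (K * (L * ‖b‖) ^ N / N.factorial) ?_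
    filter_upwards [Metric.closedBall_mem_nhds (0 : ℝ) one_pos] with t ht
    have ht1 : |t| ≤ 1 := by simpa using ht
    have := h N t ht1
    simp only [duhamelTerm_smul] at this
    refine this.trans (le_of_eq ?_)
    rw [norm_pow, Real.norm_eq_abs, mul_pow]
    ring
  refine (h2.sub h1').congr_left fun t => ?_
  simp only [smul_sub, Finset.sum_sub_distrib]
  abel

end Expansion

end

end MagnusTaylor

theorem mainTheorem6 {A : Type*} [CStarAlgebra A] (a : A) (ha : IsSelfAdjoint a) :
    (∀ (f : ℝ → ℂ) (U : Set ℝ), IsOpen U → spectrum ℝ a ⊆ U → ContDiffOn ℝ ∞ f U →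
      (∀ᶠ b in 𝓝[{b : A | IsSelfAdjoint b}] 0, spectrum ℝ (a + b) ⊆ U) ∧
      ∀ N : ℕ,
        (fun b : A => cfc (fun z : ℂ => f z.re) (a + b) -
            ∑ n ∈ Finset.range N, MagnusTaylor.taylorTerm f a n b)
          =O[𝓝[{b : A | IsSelfAdjoint b}] 0] fun b : A => ‖b‖ ^ N) ∧
    (∀ b : A, IsSelfAdjoint b →
      HasSum (fun n : ℕ => MagnusTaylor.taylorTerm (fun x : ℝ => (Real.exp x : ℂ)) a n b)
        (NormedSpace.exp (a + b))) := by
  refine ⟨fun f U hU haU hf => ⟨MagnusTaylor.eventually_spectrum_subset a hU haU, fun N =>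
    MagnusTaylor.isBigO_cfc_sub_sum_taylorTerm ha hU haU hf N⟩, fun b hb => ?_⟩
  simp only [MagnusTaylor.taylorTerm_exp ha hb]
  exact MagnusTaylor.hasSum_duhamelTerm a b
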